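/- Let $n,N$ be finite numbers of system and environment oscillators. Let $M,C\in\mathbb R^{n\times n}$ and $m,c\in\mathbb R^{N\times N}$ be symmetric positive definite (mass and spring-constant matrices of the system and of the environment), let $g\in\mathbb R^{N\times n}$ be an arbitrary coupling matrix, and let $\hbar,\beta>0$. On $L^2(\mathbb R^{N})$ and $L^2(\mathbb R^{n}\times\mathbb R^{N})$, respectively, consider the Hamiltonians (with $P=-i\hbar\nabla_X$, $p=-i\hbar\nabla_x$) $$H_E=\tfrac12\,p^{T}m^{-1}p+\tfrac12\,x^{T}c\,x,$$ $$H_C=\tfrac12P^{T}M^{-1}P+\tfrac12X^{T}CX+\tfrac12\,p^{T}m^{-1}p+\tfrac12\,(x-c^{-1}gX)^{T}c\,(x-c^{-1}gX),$$ and the partition functions $Z_C=\operatorname{Tr}e^{-\beta H_C}$, $Z_E=\operatorname{Tr}e^{-\beta H_E}$. Put $$\Omega=\bigl(M^{-1/2}CM^{-1/2}\bigr)^{1/2},\qquad \omega=\bigl(m^{-1/2}cm^{-1/2}\bigr)^{1/2},\qquad \nu_r=\frac{2\pi r}{\hbar\beta},$$ let $\gamma(t)=g^{T}m^{-1/2}\,\frac{\cos(\omega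 t)}{2\omega^{2}}\,m^{-1/2}g$ be the damping kernel, $\hat\gamma(z)=\int_0^\infty e^{-zt}\gamma(t)\,dt$ its Laplace transform, and $$\hat G(z)=\bigl[z^{2}M+2z\,\hat\gamma(z)+C\bigr]^{-1}\qquad(z>0)$$ the open-system propagator in the Laplace domain. Then $e^{-\beta H_C}$ and $e^{-\beta H_E}$ are of trace class, the infinite product below converges unconditionally, and $$Z_C \;=\; Z_E\;\det\!\Bigl(\frac{1}{\hbar\beta\,\Omega}\Bigr)\;\prod_{r=1}^{\infty}\det\!\bigl(M\,\nu_r^{2}\,\hat G(\nu_r)\bigr).$$ -/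

import Mathlib

open MeasureTheory Set Filter Topology
open scoped SchwartzMap Matrix

noncomputable section

namespace NQBM

/-! ### Quantum partition functions `Tr exp (-β H)` -/

section Quantum

universe u

/-- The Hilbert space `L²(ℝ^ι; ℂ)` of wave functions of the coordinates `q = (q_i)`. -/
abbrev WaveSpace (ι : Type u) [Fintype ι] : Type u :=
  Lp ℂ 2 (volume : Measure (EuclideanSpace ℝ ι))

/-- The `i`-th coordinate direction of `ℝ^ι`. -/
abbrev dir {ι : Type u} [Fintype ι] [DecidableEq ι] (i : ι) : EuclideanSpace ℝ ι :=
  EuclideanSpace.single i (1 : ℝ)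

/-- The Schrödinger operator obtained from `H = ½ pᵀ μ⁻¹ p + V(q)` with mass matrix `μ` by
`p_i = -iħ ∂_i`, on Schwartz functions:
`H ψ = -(ħ²/2) ∑ i j, (μ⁻¹)_ij ∂_i ∂_j ψ + V ψ`.
It is used for potentials `V` of temperate growth (see `hamiltonian_apply`). -/
def hamiltonian {ι : Type u} [Fintype ι] [DecidableEq ι] (ħ : ℝ) (μ : Matrix ι ι ℝ)
    (V : EuclideanSpace ℝ ι → ℝ) (ψ : 𝓢(EuclideanSpace ℝ ι, ℂ)) : 𝓢(EuclideanSpace ℝ ι, ℂ) :=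
  (-(ħ ^ 2 / 2)) • (∑ i, ∑ j, (μ⁻¹ i j) •
      LineDeriv.lineDerivOp (dir i) (LineDeriv.lineDerivOp (dir j) ψ))
    + SchwartzMap.smulLeftCLM ℂ (fun q => (V q : ℂ)) ψ

theorem hamiltonian_apply {ι : Type u} [Fintype ι] [DecidableEq ι] (ħ : ℝ) (μ : Matrix ι ι ℝ)
    {V : EuclideanSpace ℝ ι → ℝ} (hV : V.HasTemperateGrowth) (ψ : 𝓢(EuclideanSpace ℝ ι, ℂ))
    (q : EuclideanSpace ℝ ι) :
    hamiltonian ħ μ V ψ q =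
      -((ħ : ℂ) ^ 2 / 2) * (∑ i, ∑ j, ((μ⁻¹ i j : ℝ) : ℂ) *
        lineDeriv ℝ (fun y => lineDeriv ℝ ψ y (dir j)) q (dir i)) + (V q : ℂ) * ψ q := by
  have hV' : (fun q => (V q : ℂ)).HasTemperateGrowth :=
    Function.HasTemperateGrowth.comp Function.Complex.hasTemperateGrowth_ofReal hV
  have h2 : ∀ i j, (LineDeriv.lineDerivOp (dir i)
      (LineDeriv.lineDerivOp (dir j) ψ) : 𝓢(EuclideanSpace ℝ ι, ℂ)) q
      = lineDeriv ℝ (fun y => lineDeriv ℝ ψ y (dir j)) q (dir i) := by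
    intro i j
    rw [SchwartzMap.lineDerivOp_apply]
    congr 1
    funext y
    exact SchwartzMap.lineDerivOp_apply _ _ _
  simp only [hamiltonian, add_apply, smul_apply, sum_apply,
    SchwartzMap.smulLeftCLM_apply_apply hV', h2]
  simp

/-- `T t = exp (-t H)` for `t ≥ 0`: a strongly continuous semigroup of self-adjoint bounded
operators on `L²` whose generator is `-H` on Schwartz functions (values at `t < 0` are irrelevant).
For a Hamiltonian `H` that is essentially self-adjoint on Schwartz functions, this determines
`T t`, `t ≥ 0`. -/
structure IsBoltzmannSemigroup {ι : Type u} [Fintype ι]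
    (H : 𝓢(EuclideanSpace ℝ ι, ℂ) → 𝓢(EuclideanSpace ℝ ι, ℂ))
    (T : ℝ → (WaveSpace ι →L[ℂ] WaveSpace ι)) : Prop where
  map_zero : T 0 = 1
  map_add : ∀ s t : ℝ, 0 ≤ s → 0 ≤ t → T (s + t) = T s * T t
  isSelfAdjoint : ∀ t : ℝ, 0 ≤ t → IsSelfAdjoint (T t)
  continuousOn : ∀ f : WaveSpace ι, ContinuousOn (fun t => T t f) (Ici 0)
  hasDerivWithinAt : ∀ ψ : 𝓢(EuclideanSpace ℝ ι, ℂ),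
    HasDerivWithinAt (fun t => T t (ψ.toLp 2)) (-((H ψ).toLp 2)) (Ici 0) 0

/-- `A` is of trace class with trace `τ`: the sum of the diagonal elements `⟨e_i, A e_i⟩` converges
unconditionally to `τ` in every orthonormal basis. -/
def HasTrace {E : Type u} [NormedAddCommGroup E] [InnerProductSpace ℂ E]
    (A : E →L[ℂ] E) (τ : ℂ) : Prop :=
  ∀ (κ : Type u) (e : HilbertBasis κ ℂ E), HasSum (fun k => inner ℂ (e k) (A (e k))) τ

/-- `Z = Tr exp (-β H)`; in particular `exp (-β H)` exists and is of trace class. -/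
def HasPartitionFunction {ι : Type u} [Fintype ι]
    (H : 𝓢(EuclideanSpace ℝ ι, ℂ) → 𝓢(EuclideanSpace ℝ ι, ℂ)) (β Z : ℝ) : Prop :=
  ∃ T, IsBoltzmannSemigroup H T ∧ HasTrace (T β) (Z : ℂ)

open scoped Classical in
/-- The partition function `Z(β) = Tr exp (-β H)` (and `0` if `exp (-β H)` is not of trace
class). -/
def partitionFunction {ι : Type u} [Fintype ι]
    (H : 𝓢(EuclideanSpace ℝ ι, ℂ) → 𝓢(EuclideanSpace ℝ ι, ℂ)) (β : ℝ) : ℝ :=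
  if h : ∃ Z, HasPartitionFunction H β Z then h.choose else 0

end Quantum

/-! ### The model: system coordinates `X ∈ ℝ^n`, environment coordinates `x ∈ ℝ^N` -/

section Model

variable {n N : Type*} [Fintype n] [DecidableEq n] [Fintype N] [DecidableEq N]

/-- The potential energy of the isolated environment, `½ xᵀ c x`. -/
def envPotential (c : Matrix N N ℝ) (x : EuclideanSpace ℝ N) : ℝ :=
  (1 / 2) * (x.ofLp ⬝ᵥ (c *ᵥ x.ofLp))

/-- The system part `X` of a joint configuration `q = (X, x)`. -/
def sysPart (q : EuclideanSpace ℝ (n ⊕ N)) : n → ℝ := fun a => q (Sum.inl a)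

/-- The environment part `x` of a joint configuration `q = (X, x)`. -/
def envPart (q : EuclideanSpace ℝ (n ⊕ N)) : N → ℝ := fun k => q (Sum.inr k)

/-- The potential energy of the closed system, with the (renormalized) bilinear interaction,
`½ Xᵀ C X + ½ (x - c⁻¹ g X)ᵀ c (x - c⁻¹ g X)`. -/
def closedPotential (C : Matrix n n ℝ) (c : Matrix N N ℝ) (g : Matrix N n ℝ)
    (q : EuclideanSpace ℝ (n ⊕ N)) : ℝ :=
  (1 / 2) * (sysPart q ⬝ᵥ (C *ᵥ sysPart q)) +
    (1 / 2) * ((envPart q - (c⁻¹ * g) *ᵥ sysPart q) ⬝ᵥ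
      (c *ᵥ (envPart q - (c⁻¹ * g) *ᵥ sysPart q)))

/-- The Hamiltonian of the isolated environment, `H_E = ½ pᵀ m⁻¹ p + ½ xᵀ c x`. -/
def envHamiltonian (ħ : ℝ) (m c : Matrix N N ℝ) :
    𝓢(EuclideanSpace ℝ N, ℂ) → 𝓢(EuclideanSpace ℝ N, ℂ) :=
  hamiltonian ħ m (envPotential c)

/-- The Hamiltonian of the closed system,
`H_C = ½ Pᵀ M⁻¹ P + ½ pᵀ m⁻¹ p + ½ Xᵀ C X + ½ (x - c⁻¹ g X)ᵀ c (x - c⁻¹ g X)`. -/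
def closedHamiltonian (ħ : ℝ) (M C : Matrix n n ℝ) (m c : Matrix N N ℝ) (g : Matrix N n ℝ) :
    𝓢(EuclideanSpace ℝ (n ⊕ N), ℂ) → 𝓢(EuclideanSpace ℝ (n ⊕ N), ℂ) :=
  hamiltonian ħ (Matrix.fromBlocks M 0 0 m) (closedPotential C c g)

/-- The square root of a positive definite real matrix. -/
def msqrt (A : Matrix n n ℝ) : Matrix n n ℝ := cfc Real.sqrt A

/-- The frequency matrix of free oscillators with mass matrix `μ` and spring matrix `κ`: the
positive square root of `μ^{-1/2} κ μ^{-1/2}`. It is `Ω` for the system (`μ = M`, `κ = C`) and `ω`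
for the environment (`μ = m`, `κ = c`). -/
def freq (μ κ : Matrix n n ℝ) : Matrix n n ℝ := msqrt ((msqrt μ)⁻¹ * κ * (msqrt μ)⁻¹)

/-- The damping kernel `γ(t) = gᵀ m^{-1/2} (cos(ω t) / (2 ω²)) m^{-1/2} g`. -/
def damping (m c : Matrix N N ℝ) (g : Matrix N n ℝ) (t : ℝ) : Matrix n n ℝ :=
  gᵀ * (msqrt m)⁻¹ * cfc (fun w : ℝ => Real.cos (w * t) / (2 * w ^ 2)) (freq m c) *
    (msqrt m)⁻¹ * g

/-- The (entrywise) Laplace transform of a matrix-valued function, `∫_0^∞ e^{-zt} F(t) dt`. -/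
def laplace (F : ℝ → Matrix n n ℝ) (z : ℝ) : Matrix n n ℝ :=
  Matrix.of fun a b => ∫ t in Ioi (0 : ℝ), Real.exp (-z * t) * F t a b

/-- The propagator of the open system in the Laplace domain,
`Ĝ(z) = (z² M + 2 z γ̂(z) + C)⁻¹`. -/
def propagator (M C : Matrix n n ℝ) (m c : Matrix N N ℝ) (g : Matrix N n ℝ) (z : ℝ) :
    Matrix n n ℝ :=
  (z ^ 2 • M + (2 * z) • laplace (damping m c g) z + C)⁻¹

/-- The bosonic Matsubara frequencies `ν_r = 2 π r / (ħ β)`. -/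
def matsubara (ħ β : ℝ) (r : ℕ) : ℝ := 2 * Real.pi * r / (ħ * β)

end Model

section TemperateGrowth

/-! The potentials have temperate growth, so the Hamiltonians are the intended ones. -/

variable {n N : Type*} [Fintype n] [Fintype N]

theorem coord_growth {ι : Type*} [Fintype ι] (i : ι) :
    (fun q : EuclideanSpace ℝ ι => q i).HasTemperateGrowth :=
  (EuclideanSpace.proj (𝕜 := ℝ) i : EuclideanSpace ℝ ι →L[ℝ] ℝ).hasTemperateGrowth

theorem envPotential_hasTemperateGrowth (c : Matrix N N ℝ) :
    (envPotential c).HasTemperateGrowth := by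
  unfold envPotential
  simp only [dotProduct, Matrix.mulVec]
  refine (Function.HasTemperateGrowth.const _).mul ?_
  refine Function.HasTemperateGrowth.sum fun i _ => (coord_growth i).mul ?_
  exact Function.HasTemperateGrowth.sum fun j _ =>
    (Function.HasTemperateGrowth.const _).mul (coord_growth j)

theorem closedPotential_hasTemperateGrowth [DecidableEq N] (C : Matrix n n ℝ) (c : Matrix N N ℝ)
    (g : Matrix N n ℝ) : (closedPotential C c g).HasTemperateGrowth := by
  have hd : ∀ k : N, (fun q : EuclideanSpace ℝ (n ⊕ N) =>
      q (Sum.inr k) - ∑ a, (c⁻¹ * g) k a * q (Sum.inl a)).HasTemperateGrowth := fun k =>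
    (coord_growth _).sub (Function.HasTemperateGrowth.sum fun a _ =>
      (Function.HasTemperateGrowth.const _).mul (coord_growth _))
  unfold closedPotential
  simp only [dotProduct, Matrix.mulVec, sysPart, envPart, Pi.sub_apply]
  refine Function.HasTemperateGrowth.add ?_ ?_
  · refine (Function.HasTemperateGrowth.const _).mul ?_
    refine Function.HasTemperateGrowth.sum fun i _ => (coord_growth _).mul ?_
    exact Function.HasTemperateGrowth.sum fun j _ =>
      (Function.HasTemperateGrowth.const _).mul (coord_growth _)
  · refine (Function.HasTemperateGrowth.const _).mul ?_
    refine Function.HasTemperateGrowth.sum fun i _ => (hd i).mul ?_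
    exact Function.HasTemperateGrowth.sum fun j _ =>
      (Function.HasTemperateGrowth.const _).mul (hd j)

end TemperateGrowth

end NQBM

end

noncomputable section

namespace NQBM

set_option linter.unusedSectionVars false

/-! ### Diagonalization of positive definite matrices and normal modes -/

section MatrixAnalysis

variable {n : Type*} [Fintype n] [DecidableEq n]

/-! Both Hamiltonians have the form `½ pᵀ μ⁻¹ p + ½ qᵀ κ q` with `μ`, `κ` positive definite. For the
closed system `μ` is block diagonal and `κ = Sᵀ diag(C, c) S` with the unipotent shear `S : (X, x) ↦
(X, x - c⁻¹ g X)`. Normal modes (`exists_normalModes`) turn such a Hamiltonian into independent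
oscillators of frequencies `w k`, so that `Z = ∏ k, (2 sinh (ħβ w k / 2))⁻¹`
(`partitionFunction_oscillators`).

Euler's product for `sinh` removes the individual frequencies: `(Z det (ħβ freq μ κ))⁻¹ = ∏ r, det
(ν_r² μ + κ) / det (ν_r² μ)` (`hasProd_matsubara`). The theorem is the quotient of this identity for
the environment by the one for the closed system. In the quotient of the factors, the Schur
complement of the environment block (`det_closed`) leaves `ν² M + gᵀ (c⁻¹ - (ν² m + c)⁻¹) g + C`,
whose middle term is `2ν γ̂(ν)` (`two_mul_laplace_damping`); this is the inverse propagator. In the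
prefactors, `det freq = √(det κ / det μ)` and `det S = 1` split the closed determinant into those of
`Ω` and `ω` (`det_freq_closed`), and the latter cancels.

The analytic part justifies the formula for `Z`. Ladder operators produce orthonormal Hermite
functions, which are complete because a function orthogonal to all polynomials times a Gaussian has
vanishing Fourier transform after multiplication with that Gaussian. In this basis the semigroup is
diagonal and its trace is a convergent positive series. Conversely, any Boltzmann semigroup acts on
the eigenvectors by `exp (-t E)`, so the trace does not depend on the semigroup chosen. -/

theorem exists_diagonalization {A : Matrix n n ℝ} (hA : A.PosDef) :
    ∃ (U : Matrix n n ℝ) (w : n → ℝ), Uᵀ * U = 1 ∧ U * Uᵀ = 1 ∧ (∀ k, 0 < w k) ∧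
      (∀ f : ℝ → ℝ, cfc f A = U * Matrix.diagonal (fun k => f (w k)) * Uᵀ) ∧
      A = U * Matrix.diagonal w * Uᵀ := by
  have hU := hA.1.eigenvectorUnitary.2
  refine ⟨hA.1.eigenvectorUnitary, hA.1.eigenvalues, ?_, ?_, hA.eigenvalues_pos, fun f => ?_, ?_⟩
  · exact (Unitary.mem_iff.1 hU).1
  · exact (Unitary.mem_iff.1 hU).2
  · rw [hA.1.cfc_eq f, Matrix.IsHermitian.cfc, Unitary.conjStarAlgAut_apply]
    rfl
  · conv_lhs => rw [hA.1.spectral_theorem, Unitary.conjStarAlgAut_apply]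
    rfl

theorem msqrt_posDef {A : Matrix n n ℝ} (hA : A.PosDef) : (msqrt A).PosDef := by
  obtain ⟨U, w, h1, h2, hw, hf, -⟩ := exists_diagonalization hA
  rw [msqrt, hf]
  have hU : IsUnit U := IsUnit.of_mul_eq_one Uᵀ h2
  have := (Matrix.IsUnit.posDef_star_right_conjugate_iff hU
    (x := Matrix.diagonal fun k => √(w k))).2
    (Matrix.PosDef.diagonal fun k => Real.sqrt_pos.2 (hw k))
  simpa [Matrix.star_eq_conjTranspose] using this

theorem msqrt_mul_self {A : Matrix n n ℝ} (hA : A.PosDef) : msqrt A * msqrt A = A := by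
  obtain ⟨U, w, h1, h2, hw, hf, hA'⟩ := exists_diagonalization hA
  rw [msqrt, hf]
  calc U * Matrix.diagonal (fun k => √(w k)) * Uᵀ * (U * Matrix.diagonal (fun k => √(w k)) * Uᵀ)
      = U * Matrix.diagonal (fun k => √(w k)) * (Uᵀ * U) *
          Matrix.diagonal (fun k => √(w k)) * Uᵀ := by simp only [Matrix.mul_assoc]
    _ = A := by
      rw [h1, Matrix.mul_one, Matrix.mul_assoc U, Matrix.diagonal_mul_diagonal]
      simp only [Real.mul_self_sqrt (hw _).le]
      exact hA'.symm

theorem msqrt_transpose {A : Matrix n n ℝ} (hA : A.PosDef) : (msqrt A)ᵀ = msqrt A := by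
  simpa using (msqrt_posDef hA).1.eq

theorem isUnit_det_msqrt {A : Matrix n n ℝ} (hA : A.PosDef) : IsUnit (msqrt A).det :=
  (msqrt_posDef hA).det_pos.ne'.isUnit

theorem posDef_conj_inv_msqrt {μ κ : Matrix n n ℝ} (hμ : μ.PosDef) (hκ : κ.PosDef) :
    ((msqrt μ)⁻¹ * κ * (msqrt μ)⁻¹).PosDef := by
  have hU : IsUnit (msqrt μ)⁻¹ := (msqrt_posDef hμ).inv.isUnit
  have h := (Matrix.IsUnit.posDef_star_right_conjugate_iff hU (x := κ)).2 hκ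
  rwa [Matrix.star_eq_conjTranspose, (msqrt_posDef hμ).inv.1.eq] at h

theorem freq_posDef {μ κ : Matrix n n ℝ} (hμ : μ.PosDef) (hκ : κ.PosDef) :
    (freq μ κ).PosDef :=
  msqrt_posDef (posDef_conj_inv_msqrt hμ hκ)

theorem freq_mul_self {μ κ : Matrix n n ℝ} (hμ : μ.PosDef) (hκ : κ.PosDef) :
    freq μ κ * freq μ κ = (msqrt μ)⁻¹ * κ * (msqrt μ)⁻¹ :=
  msqrt_mul_self (posDef_conj_inv_msqrt hμ hκ)

theorem msqrt_conj_freq_sq {μ κ : Matrix n n ℝ} (hμ : μ.PosDef) (hκ : κ.PosDef) :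
    msqrt μ * (freq μ κ * freq μ κ) * msqrt μ = κ := by
  rw [freq_mul_self hμ hκ]
  have h := isUnit_det_msqrt hμ
  simp only [Matrix.mul_assoc, Matrix.nonsing_inv_mul _ h, Matrix.mul_one]
  rw [← Matrix.mul_assoc, Matrix.mul_nonsing_inv _ h, Matrix.one_mul]

/-- Taking determinants in `μ^{1/2} freq² μ^{1/2} = κ` suffices; the product of the normal
frequencies is thus known without diagonalizing. -/
theorem det_freq {μ κ : Matrix n n ℝ} (hμ : μ.PosDef) (hκ : κ.PosDef) :
    (freq μ κ).det = √(κ.det / μ.det) := by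
  have h1 : μ.det * ((freq μ κ).det * (freq μ κ).det) = κ.det := by
    conv_rhs => rw [← msqrt_conj_freq_sq hμ hκ]
    have h2 := congrArg Matrix.det (msqrt_mul_self hμ)
    rw [Matrix.det_mul] at h2
    simp only [Matrix.det_mul]
    linear_combination (-(freq μ κ).det * (freq μ κ).det) * h2
  have h0 := hμ.det_pos
  rw [← h1, mul_div_cancel_left₀ _ h0.ne', Real.sqrt_mul_self (freq_posDef hμ hκ).det_pos.le]

theorem inv_orthogonal_conj_diagonal {U : Matrix n n ℝ} (h1 : Uᵀ * U = 1) (h2 : U * Uᵀ = 1)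
    {d : n → ℝ} (hd : ∀ k, d k ≠ 0) :
    (U * Matrix.diagonal d * Uᵀ)⁻¹ = U * Matrix.diagonal (fun k => (d k)⁻¹) * Uᵀ := by
  apply Matrix.inv_eq_right_inv
  calc U * Matrix.diagonal d * Uᵀ * (U * Matrix.diagonal (fun k => (d k)⁻¹) * Uᵀ)
      = U * Matrix.diagonal d * (Uᵀ * U) * Matrix.diagonal (fun k => (d k)⁻¹) * Uᵀ := by
        simp only [Matrix.mul_assoc]
    _ = 1 := by
      rw [h1, Matrix.mul_one, Matrix.mul_assoc U, Matrix.diagonal_mul_diagonal]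
      simp [hd, h2]

/-- The eigendecomposition of the frequency matrix in terms of the mass and spring matrices. -/
theorem exists_freq_diagonalization {μ κ : Matrix n n ℝ} (hμ : μ.PosDef) (hκ : κ.PosDef) :
    ∃ (U : Matrix n n ℝ) (w : n → ℝ), Uᵀ * U = 1 ∧ U * Uᵀ = 1 ∧ (∀ k, 0 < w k) ∧
      (∀ f : ℝ → ℝ, cfc f (freq μ κ) = U * Matrix.diagonal (fun k => f (w k)) * Uᵀ) ∧
      freq μ κ = U * Matrix.diagonal w * Uᵀ ∧
      ∀ z : ℝ, z ^ 2 • μ + κ =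
        msqrt μ * (U * Matrix.diagonal (fun k => z ^ 2 + w k ^ 2) * Uᵀ) * msqrt μ := by
  obtain ⟨U, w, h1, h2, hw, hf, hA⟩ := exists_diagonalization (freq_posDef hμ hκ)
  refine ⟨U, w, h1, h2, hw, hf, hA, fun z => ?_⟩
  have hd : Matrix.diagonal (fun k => z ^ 2 + w k ^ 2) =
      z ^ 2 • (1 : Matrix n n ℝ) + Matrix.diagonal w * Matrix.diagonal w := by
    rw [← Matrix.diagonal_one, Matrix.diagonal_mul_diagonal, ← Matrix.diagonal_smul,
      Matrix.diagonal_add]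
    congr 1
    funext k
    simp [sq]
  have hsq : freq μ κ * freq μ κ = U * (Matrix.diagonal w * Matrix.diagonal w) * Uᵀ := by
    rw [hA]
    calc _ = U * Matrix.diagonal w * (Uᵀ * U) * Matrix.diagonal w * Uᵀ := by
          simp only [Matrix.mul_assoc]
      _ = _ := by rw [h1]; simp only [Matrix.mul_assoc, Matrix.one_mul]
  rw [hd, Matrix.mul_add, Matrix.add_mul, ← hsq, Matrix.mul_add, Matrix.add_mul,
    msqrt_conj_freq_sq hμ hκ]
  simp [h2, msqrt_mul_self hμ]

/-- Normal modes: a linear change of coordinates which diagonalizes the kinetic and the potential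
energy of coupled oscillators simultaneously. -/
theorem exists_normalModes {μ κ : Matrix n n ℝ} (hμ : μ.PosDef) (hκ : κ.PosDef) {ħ : ℝ}
    (hħ : 0 < ħ) :
    ∃ (w : n → ℝ) (B : Matrix n n ℝ), (∀ k, 0 < w k) ∧ IsUnit B.det ∧
      B * μ⁻¹ * Bᵀ = Matrix.diagonal (fun k => w k / ħ) ∧
      κ = Bᵀ * Matrix.diagonal (fun k => ħ * w k) * B ∧
      (∏ k, w k = (freq μ κ).det) ∧
      ∀ z : ℝ, (z ^ 2 • μ + κ).det = μ.det * ∏ k, (z ^ 2 + w k ^ 2) := by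
  obtain ⟨U, w, h1, h2, hw, -, hA, hz⟩ := exists_freq_diagonalization hμ hκ
  have hR := isUnit_det_msqrt hμ
  have hRt := msqrt_transpose hμ
  have hs : ∀ k, 0 < w k / ħ := fun k => div_pos (hw k) hħ
  have hUd : Uᵀ.det * U.det = 1 := by rw [← Matrix.det_mul, h1, Matrix.det_one]
  -- The orthogonal `U` diagonalizes the mass-weighted problem; the extra scaling by `√(w k / ħ)`
  -- makes each mode coordinate dimensionless, so that mode `k` contributes `(ħ w k / 2)(y² - ∂²)`.
  refine ⟨w, Matrix.diagonal (fun k => √(w k / ħ)) * Uᵀ * msqrt μ, hw, ?_, ?_, ?_, ?_, ?_⟩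
  · rw [Matrix.det_mul, Matrix.det_mul, Matrix.det_diagonal]
    refine IsUnit.mul (IsUnit.mul ?_ (IsUnit.of_mul_eq_one _ hUd)) hR
    exact (Finset.prod_ne_zero_iff.2 fun k _ => (Real.sqrt_pos.2 (hs k)).ne').isUnit
  · have hmid : msqrt μ * μ⁻¹ * msqrt μ = 1 := by
      conv_lhs => rw [← msqrt_mul_self hμ, Matrix.mul_inv_rev]
      rw [msqrt_mul_self hμ, ← Matrix.mul_assoc, Matrix.mul_nonsing_inv _ hR, Matrix.one_mul,
        Matrix.nonsing_inv_mul _ hR]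
    simp only [Matrix.transpose_mul, Matrix.transpose_transpose, Matrix.diagonal_transpose, hRt]
    calc Matrix.diagonal (fun k => √(w k / ħ)) * Uᵀ * msqrt μ * μ⁻¹ *
          (msqrt μ * (U * Matrix.diagonal (fun k => √(w k / ħ))))
        = Matrix.diagonal (fun k => √(w k / ħ)) * (Uᵀ * (msqrt μ * μ⁻¹ * msqrt μ) * U) *
          Matrix.diagonal (fun k => √(w k / ħ)) := by simp only [Matrix.mul_assoc]
      _ = _ := by
        rw [hmid, Matrix.mul_one, h1, Matrix.mul_one, Matrix.diagonal_mul_diagonal]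
        simp only [Real.mul_self_sqrt (hs _).le]
  · simp only [Matrix.transpose_mul, Matrix.transpose_transpose, Matrix.diagonal_transpose, hRt]
    have h0 := hz 0
    simp only [ne_eq, OfNat.ofNat_ne_zero, not_false_eq_true, zero_pow, zero_smul, zero_add] at h0
    rw [h0]
    have hd : Matrix.diagonal (fun k => w k ^ 2) = Matrix.diagonal (fun k => √(w k / ħ)) *
        Matrix.diagonal (fun k => ħ * w k) * Matrix.diagonal (fun k => √(w k / ħ)) := by
      rw [Matrix.diagonal_mul_diagonal, Matrix.diagonal_mul_diagonal]
      congr 1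
      funext k
      rw [mul_right_comm, Real.mul_self_sqrt (hs k).le]
      field_simp
    conv_lhs => rw [hd]
    simp only [Matrix.mul_assoc]
  · rw [hA, Matrix.det_mul, Matrix.det_mul, Matrix.det_diagonal, mul_right_comm,
      mul_comm U.det, hUd, one_mul]
  · intro z
    rw [hz z]
    conv_rhs => rw [← msqrt_mul_self hμ]
    simp only [Matrix.det_mul, Matrix.det_diagonal]
    linear_combination (msqrt μ).det ^ 2 * (∏ k, (z ^ 2 + w k ^ 2)) * hUd

end MatrixAnalysis

/-! ### The Gaussian Schwartz function -/

section Gaussian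

open scoped Nat

/-- The exponential series dominates the power by `m! exp (1 + r)`, and `(r - 1)² ≥ 0` trades the
Gaussian for `exp (3/2 - (1 + r))`. -/
theorem one_add_pow_mul_exp_neg_sq_le (m : ℕ) {r : ℝ} (hr : 0 ≤ r) :
    (1 + r) ^ m * Real.exp (-(1 / 2) * r ^ 2) ≤ m ! * Real.exp (3 / 2) := by
  have h1 : (1 + r) ^ m ≤ m ! * Real.exp (1 + r) := by
    have := Real.pow_div_factorial_le_exp (1 + r) (by positivity) m
    rwa [div_le_iff₀' (by positivity)] at this
  have h2 : Real.exp (-(1 / 2) * r ^ 2) ≤ Real.exp (3 / 2) * Real.exp (-(1 + r)) := by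
    rw [← Real.exp_add]
    exact Real.exp_le_exp.2 (by nlinarith [sq_nonneg (r - 1)])
  calc (1 + r) ^ m * Real.exp (-(1 / 2) * r ^ 2)
      ≤ (m ! * Real.exp (1 + r)) * (Real.exp (3 / 2) * Real.exp (-(1 + r))) := by gcongr
    _ = m ! * Real.exp (3 / 2) * (Real.exp (1 + r) * Real.exp (-(1 + r))) := by ring
    _ = m ! * Real.exp (3 / 2) := by rw [← Real.exp_add]; simp

variable {E : Type*} [NormedAddCommGroup E] [InnerProductSpace ℝ E]

/-- Every derivative of `exp` is `exp` and the exponent has temperate growth, so the Faà di Bruno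
bound gives a Gaussian times a polynomial. -/
theorem decay_gaussian (k n : ℕ) : ∃ C : ℝ, ∀ x : E,
    ‖x‖ ^ k * ‖iteratedFDeriv ℝ n (Real.exp ∘ fun x : E => -(1 / 2) * ‖x‖ ^ 2) x‖ ≤ C := by
  have htg : (fun x : E => -(1 / 2) * ‖x‖ ^ 2).HasTemperateGrowth :=
    (Function.HasTemperateGrowth.const _).mul (Function.hasTemperateGrowth_norm_sq E)
  obtain ⟨p, C, hC, hb⟩ := htg.norm_iteratedFDeriv_le_uniform n
  refine ⟨n ! * (1 + C) ^ n * ((k + p * n)! * Real.exp (3 / 2)), fun x => ?_⟩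
  have hx1 : (1 : ℝ) ≤ (1 + ‖x‖) ^ p := one_le_pow₀ (by linarith [norm_nonneg x])
  -- Enlarging `C` to `1 + C` makes the base at least `1`, hence bounded by its own positive powers,
  -- as the composition bound requires.
  have hD1 : 1 ≤ (1 + C) * (1 + ‖x‖) ^ p := by nlinarith
  have key := norm_iteratedFDeriv_comp_le (n := n) Real.contDiff_exp htg.1
    (mod_cast le_top) x (C := Real.exp (-(1 / 2) * ‖x‖ ^ 2)) (D := (1 + C) * (1 + ‖x‖) ^ p)
    (fun i _ => by
      rw [norm_iteratedFDeriv_eq_norm_iteratedDeriv, iteratedDeriv_eq_iterate, Real.iter_deriv_exp,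
        Real.norm_of_nonneg (Real.exp_pos _).le])
    (fun i hi hin => (hb i hin x).trans <| by
      calc C * (1 + ‖x‖) ^ p ≤ (1 + C) * (1 + ‖x‖) ^ p := by nlinarith
        _ ≤ _ := le_self_pow₀ hD1 (by omega))
  calc ‖x‖ ^ k * _ ≤ (1 + ‖x‖) ^ k *
        (n ! * Real.exp (-(1 / 2) * ‖x‖ ^ 2) * ((1 + C) * (1 + ‖x‖) ^ p) ^ n) := by
        gcongr
        linarith
    _ = n ! * (1 + C) ^ n *
        ((1 + ‖x‖) ^ (k + p * n) * Real.exp (-(1 / 2) * ‖x‖ ^ 2)) := by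
        rw [pow_add, pow_mul, mul_pow]; ring
    _ ≤ _ := by
        exact mul_le_mul_of_nonneg_left (one_add_pow_mul_exp_neg_sq_le _ (norm_nonneg x))
          (by positivity)

/-- The Gaussian `exp (-‖x‖² / 2)` as a real Schwartz function. -/
def gaussianReal : 𝓢(E, ℝ) where
  toFun := Real.exp ∘ fun x : E => -(1 / 2) * ‖x‖ ^ 2
  smooth' := Real.contDiff_exp.comp (contDiff_const.mul (contDiff_norm_sq ℝ))
  decay' := decay_gaussian

/-- The Gaussian `exp (-‖x‖² / 2)` as a complex Schwartz function. -/
def gaussian : 𝓢(E, ℂ) where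
  toFun x := (Real.exp (-(1 / 2) * ‖x‖ ^ 2) : ℝ)
  smooth' := Complex.ofRealCLM.contDiff.comp (gaussianReal (E := E)).smooth'
  decay' := ((gaussianReal (E := E)).postcompCLM (𝕜 := ℝ) Complex.ofRealCLM).decay'

theorem gaussian_apply (x : E) : gaussian x = (Real.exp (-(1 / 2) * ‖x‖ ^ 2) : ℝ) := rfl

open LineDeriv in
theorem lineDeriv_gaussian (v x : E) :
    (∂_{v} (gaussian : 𝓢(E, ℂ)) : 𝓢(E, ℂ)) x = -((inner ℝ x v : ℝ) : ℂ) * gaussian x := by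
  rw [SchwartzMap.lineDerivOp_apply_eq_fderiv]
  have h1 : HasFDerivAt (fun y : E => Real.exp (-(1 / 2) * ‖y‖ ^ 2))
      (Real.exp (-(1 / 2) * ‖x‖ ^ 2) • ((-(1 / 2) : ℝ) • ((2 : ℕ) • innerSL ℝ x))) x :=
    ((hasStrictFDerivAt_norm_sq x).hasFDerivAt.const_mul _).exp
  have h2 : HasFDerivAt (gaussian : 𝓢(E, ℂ)) _ x := Complex.ofRealCLM.hasFDerivAt.comp x h1
  rw [h2.fderiv]
  simp [gaussian_apply]
  ring

end Gaussian

/-! ### Position and derivative operators on Schwartz functions -/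

section Operators

variable {E : Type*} [NormedAddCommGroup E] [NormedSpace ℝ E]

open LineDeriv

theorem clm_ofReal_hasTemperateGrowth (l : E →L[ℝ] ℝ) :
    (fun q => (l q : ℂ)).HasTemperateGrowth :=
  Function.HasTemperateGrowth.comp Function.Complex.hasTemperateGrowth_ofReal
    l.hasTemperateGrowth

/-- Multiplication with the linear functional `l`. -/
def posOp (l : E →L[ℝ] ℝ) : Module.End ℂ 𝓢(E, ℂ) :=
  (SchwartzMap.smulLeftCLM ℂ (fun q => (l q : ℂ)) : 𝓢(E, ℂ) →L[ℂ] 𝓢(E, ℂ)).toLinearMap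

/-- The derivative in the direction `v`. -/
def derOp (v : E) : Module.End ℂ 𝓢(E, ℂ) :=
  (lineDerivOpCLM ℂ 𝓢(E, ℂ) v).toLinearMap

theorem posOp_apply (l : E →L[ℝ] ℝ) (ψ : 𝓢(E, ℂ)) (q : E) : posOp l ψ q = l q * ψ q := by
  simp [posOp, SchwartzMap.smulLeftCLM_apply_apply (clm_ofReal_hasTemperateGrowth l)]

theorem derOp_eq (v : E) (ψ : 𝓢(E, ℂ)) : derOp v ψ = ∂_{v} ψ := rfl

theorem derOp_apply (v : E) (ψ : 𝓢(E, ℂ)) (q : E) : derOp v ψ q = fderiv ℝ ψ q v :=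
  SchwartzMap.lineDerivOp_apply_eq_fderiv v ψ q

theorem posOp_commute (l l' : E →L[ℝ] ℝ) : Commute (posOp l) (posOp l') := by
  refine LinearMap.ext fun ψ => SchwartzMap.ext fun q => ?_
  simp only [Module.End.mul_apply, posOp_apply]
  ring

theorem derOp_commute (v w : E) : Commute (derOp v) (derOp w) := by
  refine LinearMap.ext fun ψ => SchwartzMap.ext fun q => ?_
  have h : ∀ v w : E, (derOp v * derOp w) ψ q = fderiv ℝ (fderiv ℝ ψ) q v w := by
    intro v w
    rw [Module.End.mul_apply, derOp_apply]
    have hd : DifferentiableAt ℝ (fderiv ℝ ψ) q :=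
      (SchwartzMap.fderivCLM ℂ E ℂ ψ).differentiableAt
    have : (derOp w ψ : E → ℂ) = fun y => fderiv ℝ ψ y w := funext fun y => derOp_apply w ψ y
    rw [this, fderiv_clm_apply hd (differentiableAt_const _)]
    simp
  rw [h v w, h w v]
  exact (ψ.contDiffAt 2).isSymmSndFDerivAt (by simp) v w

/-- The canonical commutation relation, which is the Leibniz rule. -/
theorem derOp_mul_posOp (v : E) (l : E →L[ℝ] ℝ) :
    derOp v * posOp l = posOp l * derOp v + (l v : ℂ) • 1 := by
  refine LinearMap.ext fun ψ => SchwartzMap.ext fun q => ?_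
  simp only [Module.End.mul_apply, LinearMap.add_apply, LinearMap.smul_apply,
    Module.End.one_apply, add_apply, smul_apply, posOp_apply, derOp_apply]
  have h1 : HasFDerivAt (fun y => (l y : ℂ)) (Complex.ofRealCLM.comp l) q :=
    Complex.ofRealCLM.hasFDerivAt.comp q l.hasFDerivAt
  have h2 : HasFDerivAt (posOp l ψ) _ q :=
    (h1.mul (SchwartzMap.hasFDerivAt ψ q)).congr_of_eventuallyEq
      (Eventually.of_forall fun y => posOp_apply l ψ y)
  rw [h2.fderiv]
  simp [mul_comm]

theorem posOp_sum {ι : Type*} (s : Finset ι) (a : ι → ℝ) (l : ι → E →L[ℝ] ℝ) :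
    posOp (∑ i ∈ s, a i • l i) = ∑ i ∈ s, (a i : ℂ) • posOp (l i) := by
  refine LinearMap.ext fun ψ => SchwartzMap.ext fun q => ?_
  simp [posOp_apply, LinearMap.sum_apply, Finset.sum_mul, mul_assoc]

theorem derOp_sum {ι : Type*} (s : Finset ι) (a : ι → ℝ) (v : ι → E) :
    derOp (∑ i ∈ s, a i • v i) = ∑ i ∈ s, (a i : ℂ) • derOp (v i) := by
  refine LinearMap.ext fun ψ => SchwartzMap.ext fun q => ?_
  simp [derOp_apply, LinearMap.sum_apply]

variable [FiniteDimensional ℝ E] [MeasurableSpace E] [BorelSpace E]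
  (μ : Measure E) [μ.IsAddHaarMeasure]

theorem inner_posOp (l : E →L[ℝ] ℝ) (φ ψ : 𝓢(E, ℂ)) :
    inner ℂ (φ.toLp 2 μ) ((posOp l ψ).toLp 2 μ) = inner ℂ ((posOp l φ).toLp 2 μ) (ψ.toLp 2 μ) := by
  simp only [SchwartzMap.inner_toL2_toL2_eq]
  congr 1
  funext x
  simp only [posOp_apply, RCLike.inner_apply, map_mul, Complex.conj_ofReal]
  ring

/-- Integration by parts; Schwartz decay removes the boundary terms. -/
theorem inner_derOp (v : E) (φ ψ : 𝓢(E, ℂ)) :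
    inner ℂ (φ.toLp 2 μ) ((derOp v ψ).toLp 2 μ) =
      -inner ℂ ((derOp v φ).toLp 2 μ) (ψ.toLp 2 μ) := by
  have h := SchwartzMap.integral_bilinear_lineDerivOp_right_eq_neg_left (μ := μ) φ ψ
    ((ContinuousLinearMap.mul ℝ ℂ).comp (Complex.conjCLE : ℂ →L[ℝ] ℂ)) v
  simp only [SchwartzMap.inner_toL2_toL2_eq, derOp_eq, RCLike.inner_apply]
  simpa [mul_comm] using h

end Operators

/-! ### Ladder operators -/

section Ladder

variable {ι V F : Type*} [Fintype ι] [DecidableEq ι] [AddCommGroup V] [Module ℂ V]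
  [NormedAddCommGroup F] [InnerProductSpace ℂ F]

/-- Lowering operators `a k` and raising operators `b k` on a space `V` of nice vectors of a Hilbert
space, with vacuum `v₀`. -/
structure IsLadder (J : V →ₗ[ℂ] F) (a b : ι → Module.End ℂ V) (v₀ : V) : Prop where
  injective : Function.Injective J
  comm : ∀ k l, a k * b l = b l * a k + if k = l then 1 else 0
  raising_comm : ∀ k l, Commute (b k) (b l)
  adjoint : ∀ k v w, inner ℂ (J v) (J (b k w)) = inner ℂ (J (a k v)) (J w)
  vacuum_ne : v₀ ≠ 0
  lowering_vacuum : ∀ k, a k v₀ = 0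

theorem pi_nat_induction {P : (ι → ℕ) → Prop} (h0 : P 0)
    (hs : ∀ α k, P α → P (α + Pi.single k 1)) (α : ι → ℕ) : P α := by
  have key : ∀ (m : ℕ) (α : ι → ℕ), ∑ i, α i = m → P α := by
    intro m
    induction m with
    | zero =>
      intro α hα
      have : α = 0 := by
        funext i
        simpa using (Finset.sum_eq_zero_iff.1 hα) i (Finset.mem_univ i)
      rwa [this]
    | succ m ih =>
      intro α hα
      obtain ⟨k, -, hk⟩ : ∃ k ∈ Finset.univ, α k ≠ 0 :=
        Finset.exists_ne_zero_of_sum_ne_zero (by omega)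
      have hle : Pi.single k 1 ≤ α := by
        intro i
        by_cases h : i = k
        · subst h; simpa using Nat.one_le_iff_ne_zero.2 hk
        · simp [h]
      have hsub : α - Pi.single k 1 + Pi.single k 1 = α := tsub_add_cancel_of_le hle
      rw [← hsub]
      refine hs _ _ (ih _ ?_)
      have h2 : ∑ i, (α - Pi.single k 1 + Pi.single k 1 : ι → ℕ) i = m + 1 := by rw [hsub, hα]
      simp only [Pi.add_apply, Finset.sum_add_distrib, Finset.sum_pi_single', Finset.mem_univ,
        if_true] at h2
      omega
  exact key _ α rfl

theorem powersHom_commute {b : ι → Module.End ℂ V} (hb : ∀ k l, Commute (b k) (b l)) :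
    Pairwise fun k l => ∀ x y, Commute (powersHom (Module.End ℂ V) (b k) x)
      (powersHom (Module.End ℂ V) (b l) y) := fun k l _ x y => by
  simpa [powersHom_apply] using (hb k l).pow_pow _ _

/-- The vector `∏ k, (b k) ^ (α k) v₀`. -/
def ladderState (b : ι → Module.End ℂ V) (hb : ∀ k l, Commute (b k) (b l)) (v₀ : V)
    (α : ι → ℕ) : V :=
  MonoidHom.noncommPiCoprod (N := fun _ : ι => Multiplicative ℕ)
    (fun k => powersHom (Module.End ℂ V) (b k))
    (powersHom_commute hb)
    (fun k => Multiplicative.ofAdd (α k)) v₀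

variable {J : V →ₗ[ℂ] F} {a b : ι → Module.End ℂ V} {v₀ : V}

theorem ladderState_zero (hb : ∀ k l, Commute (b k) (b l)) : ladderState b hb v₀ 0 = v₀ := by
  unfold ladderState
  have : (fun k : ι => Multiplicative.ofAdd ((0 : ι → ℕ) k)) = 1 := rfl
  rw [this, map_one, Module.End.one_apply]

theorem ladderState_add_single (hb : ∀ k l, Commute (b k) (b l)) (α : ι → ℕ) (k : ι) :
    ladderState b hb v₀ (α + Pi.single k 1) = b k (ladderState b hb v₀ α) := by
  unfold ladderState
  have : (fun l : ι => Multiplicative.ofAdd ((α + Pi.single k 1 : ι → ℕ) l)) =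
      Pi.mulSingle k (Multiplicative.ofAdd 1) * fun l => Multiplicative.ofAdd (α l) := by
    funext l
    rw [Pi.mul_apply, Pi.add_apply, add_comm, ofAdd_add]
    congr 1
  rw [this, map_mul, MonoidHom.noncommPiCoprod_mulSingle, Module.End.mul_apply]
  simp [powersHom_apply]

namespace IsLadder

variable (h : IsLadder J a b v₀)
include h

/-- Commuting `b k * a k` past a further raising operator `b l` adds one quantum exactly when `k =
l`. -/
theorem number_ladderState (k : ι) (α : ι → ℕ) :
    b k (a k (ladderState b h.raising_comm v₀ α)) =
      (α k : ℂ) • ladderState b h.raising_comm v₀ α := by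
  induction α using pi_nat_induction with
  | h0 => simp [ladderState_zero, h.lowering_vacuum]
  | hs α l ih =>
    rw [ladderState_add_single]
    set w := ladderState b h.raising_comm v₀ α
    have h1 := LinearMap.congr_fun (h.comm k l) w
    simp only [Module.End.mul_apply, LinearMap.add_apply] at h1
    have h2 := LinearMap.congr_fun (h.raising_comm k l).eq (a k w)
    simp only [Module.End.mul_apply] at h2
    rw [h1, map_add, h2, ih, map_smul]
    by_cases hkl : k = l
    · subst hkl
      simp [add_smul]
    · simp [hkl]

theorem lowering_raising_ladderState (k : ι) (α : ι → ℕ) :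
    a k (b k (ladderState b h.raising_comm v₀ α)) =
      ((α k : ℂ) + 1) • ladderState b h.raising_comm v₀ α := by
  have h1 := LinearMap.congr_fun (h.comm k k) (ladderState b h.raising_comm v₀ α)
  simp only [Module.End.mul_apply, LinearMap.add_apply, if_true, Module.End.one_apply] at h1
  rw [h1, h.number_ladderState, add_smul, one_smul]

/-- If mode `k` is occupied, the state is `b k` of another ladder state and `a k` returns a multiple
of that one. If it is empty, adjointness gives `‖J (a k v)‖² = 0`, and injectivity of `J` gives `a k
v = 0`. -/
theorem lowering_ladderState_mem_span (k : ι) (α : ι → ℕ) :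
    a k (ladderState b h.raising_comm v₀ α) ∈
      Submodule.span ℂ (range (ladderState b h.raising_comm v₀)) := by
  by_cases hk : α k = 0
  · have h1 := h.adjoint k (ladderState b h.raising_comm v₀ α)
      (a k (ladderState b h.raising_comm v₀ α))
    rw [h.number_ladderState, hk] at h1
    simp only [Nat.cast_zero, zero_smul, map_zero, inner_zero_right] at h1
    have h2 := h.injective ((inner_self_eq_zero.1 h1.symm).trans (map_zero J).symm)
    rw [h2]
    exact Submodule.zero_mem _
  · have hle : Pi.single k 1 ≤ α := by
      intro i
      by_cases h : i = k
      · subst h; simpa using Nat.one_le_iff_ne_zero.2 hk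
      · simp [h]
    rw [← tsub_add_cancel_of_le hle, ladderState_add_single, h.lowering_raising_ladderState]
    exact Submodule.smul_mem _ _ (Submodule.subset_span ⟨_, rfl⟩)

/-- Raising cannot annihilate a ladder state, since `a k * b k` multiplies it by `α k + 1 ≠ 0`. -/
theorem ladderState_ne_zero (α : ι → ℕ) : ladderState b h.raising_comm v₀ α ≠ 0 := by
  induction α using pi_nat_induction with
  | h0 => rw [ladderState_zero]; exact h.vacuum_ne
  | hs α k ih =>
    rw [ladderState_add_single]
    intro h0
    have h1 := h.lowering_raising_ladderState k α
    rw [h0, map_zero] at h1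
    have h2 : ((α k : ℂ) + 1) ≠ 0 := Nat.cast_add_one_ne_zero (α k)
    exact ih ((smul_eq_zero.1 h1.symm).resolve_left h2)

/-- These are eigenvectors of the symmetric operators `b k * a k`, and some `k` distinguishes their
eigenvalues. -/
theorem inner_ladderState {α γ : ι → ℕ} (hne : α ≠ γ) :
    inner ℂ (J (ladderState b h.raising_comm v₀ α))
      (J (ladderState b h.raising_comm v₀ γ)) = 0 := by
  obtain ⟨k, hk⟩ := Function.ne_iff.1 hne
  set v := ladderState b h.raising_comm v₀ α with hv
  set w := ladderState b h.raising_comm v₀ γ with hw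
  have h1 : inner ℂ (J v) (J (b k (a k w))) = inner ℂ (J (b k (a k v))) (J w) := by
    rw [h.adjoint, ← inner_conj_symm (J (b k (a k v))), h.adjoint, inner_conj_symm]
  rw [hv, hw, h.number_ladderState, h.number_ladderState, ← hv, ← hw, map_smul, map_smul,
    inner_smul_left, inner_smul_right, map_natCast] at h1
  have h2 : ((γ k : ℂ) - α k) * inner ℂ (J v) (J w) = 0 := by rw [sub_mul, h1, sub_self]
  refine (mul_eq_zero.1 h2).resolve_left ?_
  exact sub_ne_zero.2 (by exact_mod_cast fun h0 : γ k = α k => hk h0.symm)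

/-- The normalized ladder states. -/
theorem exists_orthonormal_states : ∃ φ : (ι → ℕ) → V, Orthonormal ℂ (fun α => J (φ α)) ∧
    (∀ k α, b k (a k (φ α)) = (α k : ℂ) • φ α) ∧
    v₀ ∈ Submodule.span ℂ (range φ) ∧
    ∀ k, ∀ v ∈ Submodule.span ℂ (range φ),
      a k v ∈ Submodule.span ℂ (range φ) ∧ b k v ∈ Submodule.span ℂ (range φ) := by
  set ψ := ladderState b h.raising_comm v₀ with hψ
  have hn : ∀ α, ‖J (ψ α)‖ ≠ 0 := fun α h0 =>
    h.ladderState_ne_zero α (h.injective ((norm_eq_zero.1 h0).trans (map_zero J).symm))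
  have hc : ∀ α, ((‖J (ψ α)‖⁻¹ : ℝ) : ℂ) ≠ 0 := fun α => by
    simpa using fun h0 => hn α (by rw [h0, norm_zero])
  have hspan : Submodule.span ℂ (range fun α => ((‖J (ψ α)‖⁻¹ : ℝ) : ℂ) • ψ α) =
      Submodule.span ℂ (range ψ) := by
    apply le_antisymm <;> rw [Submodule.span_le]
    · rintro _ ⟨α, rfl⟩
      exact Submodule.smul_mem _ _ (Submodule.subset_span ⟨α, rfl⟩)
    · rintro _ ⟨α, rfl⟩
      have := Submodule.smul_mem _ (((‖J (ψ α)‖⁻¹ : ℝ) : ℂ)⁻¹) (Submodule.subset_span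
        (R := ℂ) (s := range fun α => ((‖J (ψ α)‖⁻¹ : ℝ) : ℂ) • ψ α) ⟨α, rfl⟩)
      rwa [smul_smul, inv_mul_cancel₀ (hc α), one_smul] at this
  refine ⟨fun α => ((‖J (ψ α)‖⁻¹ : ℝ) : ℂ) • ψ α, ⟨fun α => ?_, fun α γ hne => ?_⟩,
    fun k α => ?_, ?_, fun k v hv => ?_⟩
  · dsimp only
    rw [map_smul, norm_smul, Complex.norm_real, norm_inv, norm_norm, inv_mul_cancel₀ (hn α)]
  · dsimp only
    rw [map_smul, map_smul, inner_smul_left, inner_smul_right, h.inner_ladderState hne, mul_zero,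
      mul_zero]
  · rw [map_smul, map_smul, h.number_ladderState, smul_comm]
  · rw [hspan]
    exact Submodule.subset_span ⟨0, ladderState_zero _⟩
  · rw [hspan] at hv ⊢
    have ha : Submodule.span ℂ (range ψ) ≤ (Submodule.span ℂ (range ψ)).comap (a k) := by
      rw [Submodule.span_le]
      rintro _ ⟨α, rfl⟩
      exact h.lowering_ladderState_mem_span k α
    have hb : Submodule.span ℂ (range ψ) ≤ (Submodule.span ℂ (range ψ)).comap (b k) := by
      rw [Submodule.span_le]
      rintro _ ⟨α, rfl⟩
      exact Submodule.subset_span ⟨_, ladderState_add_single _ α k⟩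
    exact ⟨ha hv, hb hv⟩

end IsLadder

end Ladder

/-! ### Completeness of polynomials times a Gaussian -/

section Completeness

open scoped FourierTransform ENNReal ContDiff Nat

variable {E E' : Type*} [NormedAddCommGroup E] [InnerProductSpace ℝ E]
  [NormedAddCommGroup E'] [InnerProductSpace ℝ E']

/-- The Gaussian `exp (-‖L q‖² / 2)`. -/
def gaussianComp (L : E ≃L[ℝ] E') : 𝓢(E, ℂ) :=
  SchwartzMap.compCLMOfContinuousLinearEquiv ℂ L gaussian

theorem gaussianComp_apply (L : E ≃L[ℝ] E') (q : E) :
    gaussianComp L q = (Real.exp (-(1 / 2) * ‖L q‖ ^ 2) : ℝ) := by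
  simp [gaussianComp, gaussian_apply]

theorem posOp_pow_apply (l : E →L[ℝ] ℝ) (n : ℕ) (ψ : 𝓢(E, ℂ)) (q : E) :
    ((posOp l) ^ n) ψ q = (l q : ℂ) ^ n * ψ q := by
  induction n with
  | zero => simp
  | succ n ih => rw [pow_succ', Module.End.mul_apply, posOp_apply, ih, pow_succ]; ring

/-- A wider Gaussian absorbs the exponential of a linear functional. This supplies the domination
for expanding a character under the integral. -/
theorem norm_gaussianComp_mul_exp_le (L : E ≃L[ℝ] E') (l : E →L[ℝ] ℝ) :
    ∃ C : ℝ, ∃ L' : E ≃L[ℝ] E', ∀ q,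
      ‖gaussianComp L q‖ * Real.exp |l q| ≤ C * ‖gaussianComp L' q‖ := by
  obtain ⟨K, hK0, hK⟩ : ∃ K : ℝ, 0 ≤ K ∧ ∀ q, |l q| ≤ K * ‖L q‖ := by
    refine ⟨‖l.comp (L.symm : E' →L[ℝ] E)‖, norm_nonneg _, fun q => ?_⟩
    simpa using (l.comp (L.symm : E' →L[ℝ] E)).le_opNorm (L q)
  -- With `s = ‖L q‖`, the inequality `-s²/2 + K s ≤ K² - s²/4` is `(K - s/2)² ≥ 0`; the exponent
  -- `-s²/4` is that of the coordinates `L / √2`.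
  refine ⟨Real.exp (K ^ 2), L.trans (ContinuousLinearEquiv.smulLeft
    (Units.mk0 (1 / √2 : ℝ) (by positivity))), fun q => ?_⟩
  have h2 : ‖(L.trans (ContinuousLinearEquiv.smulLeft
      (Units.mk0 (1 / √2 : ℝ) (by positivity)))) q‖ ^ 2 = ‖L q‖ ^ 2 / 2 := by
    have : (L.trans (ContinuousLinearEquiv.smulLeft
      (Units.mk0 (1 / √2 : ℝ) (by positivity)))) q = (1 / √2 : ℝ) • L q := rfl
    rw [this, norm_smul, mul_pow, Real.norm_eq_abs, sq_abs, div_pow, Real.sq_sqrt (by norm_num)]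
    ring
  simp only [gaussianComp_apply, Complex.norm_real, Real.norm_eq_abs, abs_of_pos (Real.exp_pos _)]
  rw [← Real.exp_add, ← Real.exp_add, h2]
  refine Real.exp_le_exp.2 ?_
  nlinarith [hK q, sq_nonneg (K - ‖L q‖ / 2)]

variable [FiniteDimensional ℝ E] [MeasurableSpace E] [BorelSpace E]

/-- An integrable function with vanishing Fourier transform vanishes. -/
theorem ae_eq_zero_of_fourier_eq_zero {h : E → ℂ} (hh : Integrable h)
    (h0 : ∀ ξ, 𝓕 h ξ = 0) : h =ᵐ[volume] 0 := by
  refine ae_eq_zero_of_integral_contDiff_smul_eq_zero hh.locallyIntegrable fun g hg hgc => ?_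
  have hg1 : HasCompactSupport (Complex.ofRealCLM ∘ g) := hgc.comp_left rfl
  have hg2 : ContDiff ℝ ∞ (Complex.ofRealCLM ∘ g) := by fun_prop
  set χ : 𝓢(E, ℂ) := hg1.toSchwartzMap hg2 with hχ
  -- The multiplication formula moves the transform from `𝓕⁻ χ` to `h`, so the integral of `h χ` is
  -- one of `𝓕 h`, which vanishes.
  have h1 := VectorFourier.integral_fourierIntegral_smul_eq_flip (μ := volume) (ν := volume)
    (L := innerₗ E) (f := h) (g := ((𝓕⁻ χ : 𝓢(E, ℂ)) : E → ℂ))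
    Real.continuous_fourierChar continuous_inner hh (𝓕⁻ χ : 𝓢(E, ℂ)).integrable
  rw [flip_innerₗ] at h1
  have h2 : ∀ x, VectorFourier.fourierIntegral Real.fourierChar volume (innerₗ E)
      ((𝓕⁻ χ : 𝓢(E, ℂ)) : E → ℂ) x = χ x := fun x => by
    have h3 : (𝓕 (𝓕⁻ χ) : 𝓢(E, ℂ)) = χ := FourierTransform.fourier_fourierInv_eq χ
    exact congrArg (fun ψ : 𝓢(E, ℂ) => ψ x) h3
  have h4 : ∀ ξ, VectorFourier.fourierIntegral Real.fourierChar volume (innerₗ E) h ξ = 0 := h0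
  simp only [h2, h4, zero_smul, integral_zero] at h1
  rw [h1]
  congr 1
  funext x
  simp [hχ, mul_comm]

/-- The product `h` of the Gaussian and the conjugate of `f` has exponential moments, so the power
series of `exp (i l)` may be integrated against it term by term. All terms vanish by assumption,
hence so does the Fourier transform of `h`. Powers of a single functional are enough. -/
theorem eq_zero_of_inner_posOp_pow_gaussian (L : E ≃L[ℝ] E')
    (f : Lp ℂ 2 (volume : Measure E))
    (hf : ∀ (l : E →L[ℝ] ℝ) (n : ℕ),
      inner ℂ f ((((posOp l) ^ n) (gaussianComp L)).toLp 2) = 0) : f = 0 := by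
  set h : E → ℂ := fun q => gaussianComp L q * (starRingEnd ℂ) (f q) with hh
  have hfm : MemLp (fun q => (starRingEnd ℂ) (f q)) 2 := (Lp.memLp f).star
  have hmem : ∀ ψ : 𝓢(E, ℂ), Integrable fun q => ψ q * (starRingEnd ℂ) (f q) := fun ψ =>
    MemLp.integrable_mul (ψ.memLp 2) hfm
  have hint : Integrable h := hmem _
  have hmom : ∀ (l : E →L[ℝ] ℝ) (n : ℕ), ∫ q, (l q : ℂ) ^ n * h q = 0 := by
    intro l n
    rw [← hf l n, L2.inner_def]
    refine integral_congr_ae ?_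
    filter_upwards [(((posOp l) ^ n) (gaussianComp L)).coeFn_toLp 2] with q hq
    rw [hq, posOp_pow_apply, RCLike.inner_apply]
    simp only [hh]
    ring
  have hexp : ∀ l : E →L[ℝ] ℝ, Integrable fun q => Real.exp |l q| * ‖h q‖ := by
    intro l
    obtain ⟨C, L', hC⟩ := norm_gaussianComp_mul_exp_le L l
    refine Integrable.mono' ((hmem (gaussianComp L')).norm.const_mul C) ?_
      (Eventually.of_forall fun q => ?_)
    · exact ((Real.continuous_exp.comp l.continuous.abs).aestronglyMeasurable).mul
        hint.aestronglyMeasurable.norm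
    · rw [Real.norm_of_nonneg (by positivity), hh, norm_mul, norm_mul]
      calc Real.exp |l q| * (‖gaussianComp L q‖ * ‖(starRingEnd ℂ) (f q)‖)
          = (‖gaussianComp L q‖ * Real.exp |l q|) * ‖(starRingEnd ℂ) (f q)‖ := by ring
        _ ≤ (C * ‖gaussianComp L' q‖) * ‖(starRingEnd ℂ) (f q)‖ := 
          mul_le_mul_of_nonneg_right (hC q) (norm_nonneg _)
        _ = _ := by ring
  have hchar : ∀ l : E →L[ℝ] ℝ, ∫ q, Complex.exp (l q * Complex.I) * h q = 0 := by
    intro l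
    have hsum := hasSum_integral_of_dominated_convergence (μ := volume)
      (F := fun (n : ℕ) q => (l q * Complex.I) ^ n / n ! * h q)
      (f := fun q => Complex.exp (l q * Complex.I) * h q)
      (fun n q => |l q| ^ n / n ! * ‖h q‖)
      (fun n => by
        refine AEStronglyMeasurable.mul (Continuous.aestronglyMeasurable ?_)
          hint.aestronglyMeasurable
        have := l.continuous
        fun_prop)
      (fun n => Eventually.of_forall fun q => by simp)
      (Eventually.of_forall fun q => (Real.summable_pow_div_factorial _).mul_right _)
      (by
        refine (hexp l).congr (Eventually.of_forall fun q => ?_)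
        simp only [tsum_mul_right]
        congr 1
        rw [Real.exp_eq_exp_ℝ, NormedSpace.exp_eq_tsum_div])
      (Eventually.of_forall fun q => by
        refine HasSum.mul_right _ ?_
        rw [Complex.exp_eq_exp_ℂ]
        exact NormedSpace.expSeries_div_hasSum_exp _)
    refine hsum.unique ?_
    convert hasSum_zero using 2 with n
    have : ∀ q, ((l q : ℂ) * Complex.I) ^ n / n ! * h q =
        (Complex.I ^ n / n !) * ((l q : ℂ) ^ n * h q) := fun q => by rw [mul_pow]; ring
    simp only [this, integral_const_mul, hmom, mul_zero]
  have hzero : h =ᵐ[volume] 0 := by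
    refine ae_eq_zero_of_fourier_eq_zero hint fun ξ => ?_
    rw [Real.fourier_eq]
    rw [← hchar ((-(2 * Real.pi)) • innerSL ℝ ξ)]
    congr 1
    funext q
    rw [Circle.smul_def, Real.fourierChar_apply, smul_eq_mul]
    congr 3
    simp [real_inner_comm]
  rw [Lp.eq_zero_iff_ae_eq_zero]
  filter_upwards [hzero] with q hq
  have hG : gaussianComp L q ≠ 0 := by
    rw [gaussianComp_apply]
    exact_mod_cast (Real.exp_pos _).ne'
  simpa [hh, hG] using hq

end Completeness

/-! ### The eigenbasis of a quadratic Hamiltonian -/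

section Eigenbasis

open LineDeriv

variable {ι : Type*} [Fintype ι] [DecidableEq ι]

/-- The `k`-th coordinate functional of the linear coordinates `L`. -/
def coordFun (L : EuclideanSpace ℝ ι ≃L[ℝ] EuclideanSpace ℝ ι) (k : ι) :
    EuclideanSpace ℝ ι →L[ℝ] ℝ :=
  (EuclideanSpace.proj k : EuclideanSpace ℝ ι →L[ℝ] ℝ).comp
    (L : EuclideanSpace ℝ ι →L[ℝ] EuclideanSpace ℝ ι)

/-- The `k`-th coordinate direction of the linear coordinates `L`. -/
def coordDir (L : EuclideanSpace ℝ ι ≃L[ℝ] EuclideanSpace ℝ ι) (k : ι) : EuclideanSpace ℝ ι :=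
  L.symm (dir k)

variable (L : EuclideanSpace ℝ ι ≃L[ℝ] EuclideanSpace ℝ ι)

theorem coordFun_apply (k : ι) (q : EuclideanSpace ℝ ι) : coordFun L k q = L q k := rfl

theorem coordFun_coordDir (k l : ι) : coordFun L k (coordDir L l) = if k = l then 1 else 0 := by
  simp [coordFun_apply, coordDir, dir]

theorem eq_sum_coordDir (q : EuclideanSpace ℝ ι) : q = ∑ k, L q k • coordDir L k := by
  apply L.injective
  simp only [map_sum, map_smul, coordDir, ContinuousLinearEquiv.apply_symm_apply, dir]
  ext k
  simp [Pi.single_apply]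

theorem clm_eq_sum_coordFun (l : EuclideanSpace ℝ ι →L[ℝ] ℝ) :
    l = ∑ k, l (coordDir L k) • coordFun L k := by
  ext q
  conv_lhs => rw [eq_sum_coordDir L q]
  simp [coordFun_apply, mul_comm]

/-- The lowering operators of the oscillator modes with coordinates `L`. -/
def lowering (k : ι) : Module.End ℂ 𝓢(EuclideanSpace ℝ ι, ℂ) :=
  ((1 / √2 : ℝ) : ℂ) • (posOp (coordFun L k) + derOp (coordDir L k))

/-- The raising operators of the oscillator modes with coordinates `L`. -/
def raising (k : ι) : Module.End ℂ 𝓢(EuclideanSpace ℝ ι, ℂ) :=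
  ((1 / √2 : ℝ) : ℂ) • (posOp (coordFun L k) - derOp (coordDir L k))

theorem inv_sqrt_two_mul_self : ((1 / √2 : ℝ) : ℂ) * ((1 / √2 : ℝ) : ℂ) = 1 / 2 := by
  rw [← Complex.ofReal_mul, div_mul_div_comm, Real.mul_self_sqrt (by norm_num)]
  norm_num

theorem derOp_mul_posOp_coord (k l : ι) :
    derOp (coordDir L k) * posOp (coordFun L l) =
      posOp (coordFun L l) * derOp (coordDir L k) + if k = l then 1 else 0 := by
  rw [derOp_mul_posOp, coordFun_coordDir]
  by_cases h : k = l
  · subst h; simp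
  · simp [h, Ne.symm h]

theorem lowering_mul_raising (k l : ι) :
    lowering L k * raising L l = raising L l * lowering L k + if k = l then 1 else 0 := by
  have h1 := derOp_mul_posOp_coord L k l
  have h2 := derOp_mul_posOp_coord L l k
  have h3 := (derOp_commute (coordDir L k) (coordDir L l)).eq
  have h4 := (posOp_commute (coordFun L k) (coordFun L l)).eq
  simp only [lowering, raising, smul_mul_smul_comm, inv_sqrt_two_mul_self, add_mul, sub_mul,
    mul_add, mul_sub, h1, h2, h3, h4]
  by_cases h : k = l
  · subst h
    simp only [if_true]
    module
  · simp only [h, Ne.symm h, if_false]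
    module

theorem raising_commute (k l : ι) : Commute (raising L k) (raising L l) := by
  have h1 := derOp_mul_posOp_coord L k l
  have h2 := derOp_mul_posOp_coord L l k
  have h3 := (derOp_commute (coordDir L k) (coordDir L l)).eq
  have h4 := (posOp_commute (coordFun L k) (coordFun L l)).eq
  unfold Commute SemiconjBy
  simp only [raising, smul_mul_smul_comm, inv_sqrt_two_mul_self, sub_mul, mul_sub, h1, h2, h3, h4]
  by_cases h : k = l
  · subst h; rfl
  · simp only [h, Ne.symm h, if_false]
    module

/-- This identifies the energy `½ (y² - ∂²)` of a mode with the number operator plus `½`. -/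
theorem raising_mul_lowering (k : ι) :
    raising L k * lowering L k = (1 / 2 : ℂ) • (posOp (coordFun L k) * posOp (coordFun L k)
      - derOp (coordDir L k) * derOp (coordDir L k) - 1) := by
  have h1 := derOp_mul_posOp_coord L k k
  simp only [if_true] at h1
  simp only [lowering, raising, smul_mul_smul_comm, inv_sqrt_two_mul_self, sub_mul, mul_add, h1]
  module

theorem derOp_gaussianComp (k : ι) :
    derOp (coordDir L k) (gaussianComp L) = -posOp (coordFun L k) (gaussianComp L) := by
  refine SchwartzMap.ext fun q => ?_
  rw [derOp_eq, gaussianComp, SchwartzMap.lineDerivOp_compCLMOfContinuousLinearEquiv,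
    ← gaussianComp, neg_apply, posOp_apply]
  simp only [SchwartzMap.compCLMOfContinuousLinearEquiv_apply, Function.comp_apply,
    lineDeriv_gaussian, gaussianComp, coordDir, ContinuousLinearEquiv.apply_symm_apply, dir,
    coordFun_apply]
  rw [EuclideanSpace.inner_single_right]
  simp

theorem isLadder : IsLadder
    (SchwartzMap.toLpCLM ℂ ℂ 2 (volume : Measure (EuclideanSpace ℝ ι))).toLinearMap
    (lowering L) (raising L) (gaussianComp L) where
  injective := SchwartzMap.injective_toLp 2 volume
  comm := lowering_mul_raising L
  raising_comm := raising_commute L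
  adjoint k v w := by
    have h1 := inner_posOp volume (coordFun L k) v w
    have h2 := inner_derOp volume (coordDir L k) v w
    simp only [← SchwartzMap.toLpCLM_apply (𝕜 := ℂ)] at h1 h2
    simp only [ContinuousLinearMap.coe_coe, lowering, raising, LinearMap.smul_apply,
      LinearMap.sub_apply, LinearMap.add_apply, map_smul, map_sub, map_add, inner_smul_left,
      inner_smul_right, inner_sub_right, inner_add_left, h1, h2, Complex.conj_ofReal]
    ring
  vacuum_ne h := by
    have := congrArg (fun ψ : 𝓢(EuclideanSpace ℝ ι, ℂ) => ψ 0) h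
    simp [gaussianComp_apply] at this
  lowering_vacuum k := by
    simp [lowering, derOp_gaussianComp]

/-- Each coordinate is a multiple of `lowering + raising`. Applied to the span of the ladder states,
this shows that it contains the polynomials times the Gaussian needed for completeness. -/
theorem posOp_mem_of_ladder_invariant {S : Submodule ℂ 𝓢(EuclideanSpace ℝ ι, ℂ)}
    (hS : ∀ k, ∀ v ∈ S, lowering L k v ∈ S ∧ raising L k v ∈ S)
    (l : EuclideanSpace ℝ ι →L[ℝ] ℝ) {v : 𝓢(EuclideanSpace ℝ ι, ℂ)} (hv : v ∈ S) :
    posOp l v ∈ S := by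
  rw [clm_eq_sum_coordFun L l, posOp_sum, LinearMap.sum_apply]
  refine Submodule.sum_mem _ fun k _ => Submodule.smul_mem _ _ ?_
  have h : posOp (coordFun L k) v = ((1 / √2 : ℝ) : ℂ) • (lowering L k v + raising L k v) := by
    simp only [lowering, raising, LinearMap.smul_apply, LinearMap.add_apply, LinearMap.sub_apply,
      ← smul_add, smul_smul, inv_sqrt_two_mul_self]
    module
  rw [h]
  exact Submodule.smul_mem _ _ (Submodule.add_mem _ (hS k v hv).1 (hS k v hv).2)

/-- The Hermite functions in the coordinates `L` form a Hilbert basis of Schwartz functions. -/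
theorem exists_hermite_basis : ∃ (φ : (ι → ℕ) → 𝓢(EuclideanSpace ℝ ι, ℂ))
    (e : HilbertBasis (ι → ℕ) ℂ (WaveSpace ι)), (∀ α, e α = (φ α).toLp 2) ∧
      ∀ k α, raising L k (lowering L k (φ α)) = (α k : ℂ) • φ α := by
  obtain ⟨φ, hφ, hnum, hvac, hinv⟩ := (isLadder L).exists_orthonormal_states
  refine ⟨φ, HilbertBasis.mkOfOrthogonalEqBot hφ ?_, fun α => ?_, hnum⟩
  · rw [Submodule.eq_bot_iff]
    intro f hf
    refine eq_zero_of_inner_posOp_pow_gaussian L f fun l n => ?_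
    have hpow : ((posOp l) ^ n) (gaussianComp L) ∈ Submodule.span ℂ (range φ) := by
      induction n with
      | zero => simpa using hvac
      | succ n ih =>
        rw [pow_succ', Module.End.mul_apply]
        exact posOp_mem_of_ladder_invariant L hinv l ih
    have hmap := Submodule.mem_map_of_mem (f := (SchwartzMap.toLpCLM ℂ ℂ 2
      (volume : Measure (EuclideanSpace ℝ ι))).toLinearMap) hpow
    rw [Submodule.map_span, ← range_comp] at hmap
    exact (Submodule.mem_orthogonal' _ _).1 hf _ hmap
  · rw [HilbertBasis.coe_mkOfOrthogonalEqBot]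
    rfl

theorem sum_sum_comm_sum_sum {A : Type*} [AddCommMonoid A] (f : ι → ι → ι → ι → A) :
    ∑ i, ∑ j, ∑ k, ∑ l, f i j k l = ∑ k, ∑ l, ∑ i, ∑ j, f i j k l := by
  have h := Finset.sum_comm (s := (Finset.univ : Finset (ι × ι)))
    (t := (Finset.univ : Finset (ι × ι))) (f := fun p q => f p.1 p.2 q.1 q.2)
  simpa only [Fintype.sum_prod_type] using h

/-- A quadratic Hamiltonian in normal mode coordinates. -/
theorem hamiltonian_eq_sum {ħ : ℝ} (hħ : 0 < ħ) {μ κ B : Matrix ι ι ℝ} {w : ι → ℝ}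
    (hL : ∀ q k, L q k = (B *ᵥ q.ofLp) k)
    (hB : B * μ⁻¹ * Bᵀ = Matrix.diagonal (fun k => w k / ħ))
    (hκ : κ = Bᵀ * Matrix.diagonal (fun k => ħ * w k) * B) (ψ : 𝓢(EuclideanSpace ℝ ι, ℂ)) :
    hamiltonian ħ μ (envPotential κ) ψ =
      ∑ k, ((ħ * w k / 2 : ℝ) : ℂ) • ((posOp (coordFun L k) * posOp (coordFun L k)
        - derOp (coordDir L k) * derOp (coordDir L k)) ψ) := by
  have hdir : ∀ i, derOp (dir i : EuclideanSpace ℝ ι) =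
      ∑ k, (B k i : ℂ) • derOp (coordDir L k) := by
    intro i
    rw [← derOp_sum]
    congr 1
    conv_lhs => rw [eq_sum_coordDir L (dir i)]
    simp [hL, dir]
  have hkin : ∑ i, ∑ j, ((μ⁻¹ i j : ℝ) : ℂ) • ((derOp (dir i) * derOp (dir j)) ψ) =
      ∑ k, ((w k / ħ : ℝ) : ℂ) • ((derOp (coordDir L k) * derOp (coordDir L k)) ψ) := by
    -- The entries of `B μ⁻¹ Bᵀ`: diagonality is what kills the mixed second derivatives.
    have hmat : ∀ k l, ∑ i, ∑ j, (μ⁻¹ i j * B k i * B l j) =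
        if k = l then w k / ħ else 0 := by
      intro k l
      have h := congrFun (congrFun hB k) l
      rw [Matrix.diagonal_apply, Matrix.mul_apply] at h
      rw [← h]
      simp only [Matrix.mul_apply, Matrix.transpose_apply, Finset.sum_mul]
      rw [Finset.sum_comm]
      refine Finset.sum_congr rfl fun i _ => Finset.sum_congr rfl fun j _ => by ring
    calc ∑ i, ∑ j, ((μ⁻¹ i j : ℝ) : ℂ) • ((derOp (dir i) * derOp (dir j)) ψ)
        = ∑ i, ∑ j, ∑ k, ∑ l, ((μ⁻¹ i j * B k i * B l j : ℝ) : ℂ) •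
            ((derOp (coordDir L k) * derOp (coordDir L l)) ψ) := by
          refine Finset.sum_congr rfl fun i _ => Finset.sum_congr rfl fun j _ => ?_
          simp only [hdir, Finset.sum_mul, Finset.mul_sum, smul_mul_smul_comm,
            LinearMap.sum_apply, LinearMap.smul_apply, Finset.smul_sum, smul_smul]
          rw [Finset.sum_comm]
          refine Finset.sum_congr rfl fun k _ => Finset.sum_congr rfl fun l _ => ?_
          push_cast
          congr 1
          ring
      _ = ∑ k, ∑ l, ((∑ i, ∑ j, (μ⁻¹ i j * B k i * B l j) : ℝ) : ℂ) •
            ((derOp (coordDir L k) * derOp (coordDir L l)) ψ) := by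
          simp only [Complex.ofReal_sum, Finset.sum_smul]
          exact sum_sum_comm_sum_sum _
      _ = _ := by
          simp only [hmat]
          refine Finset.sum_congr rfl fun k _ => ?_
          rw [Finset.sum_eq_single k]
          · simp
          · intro l _ h
            simp [Ne.symm h]
          · simp
  have hpot : ∀ q, envPotential κ q = ∑ k, ħ * w k / 2 * (L q k) ^ 2 := by
    intro q
    have h1 : q.ofLp ⬝ᵥ (κ *ᵥ q.ofLp) =
        (B *ᵥ q.ofLp) ⬝ᵥ (Matrix.diagonal (fun k => ħ * w k) *ᵥ (B *ᵥ q.ofLp)) := by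
      rw [hκ, ← Matrix.mulVec_mulVec, ← Matrix.mulVec_mulVec, Matrix.dotProduct_mulVec,
        Matrix.vecMul_transpose]
    rw [envPotential, h1, dotProduct, Finset.mul_sum]
    refine Finset.sum_congr rfl fun k _ => ?_
    rw [hL, Matrix.mulVec_diagonal]
    ring
  refine SchwartzMap.ext fun q => ?_
  have hk' := congrArg (fun χ : 𝓢(EuclideanSpace ℝ ι, ℂ) => χ q) hkin
  simp only [sum_apply, smul_apply, smul_eq_mul] at hk'
  have htg : (fun q => (envPotential κ q : ℂ)).HasTemperateGrowth :=
    Function.HasTemperateGrowth.comp Function.Complex.hasTemperateGrowth_ofReal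
      (envPotential_hasTemperateGrowth κ)
  have hkin' : (∑ i, ∑ j, (μ⁻¹ i j) • ∂_{dir i} (∂_{dir j} ψ) : 𝓢(EuclideanSpace ℝ ι, ℂ)) q =
      ∑ k, ((w k / ħ : ℝ) : ℂ) * ((derOp (coordDir L k) * derOp (coordDir L k)) ψ) q := by
    rw [← hk']
    simp only [sum_apply, smul_apply, Complex.real_smul]
    rfl
  rw [hamiltonian, add_apply, smul_apply, hkin', SchwartzMap.smulLeftCLM_apply_apply htg]
  simp only [sum_apply, smul_apply, LinearMap.sub_apply, sub_apply, Module.End.mul_apply,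
    posOp_apply, coordFun_apply, hpot, smul_eq_mul, Complex.real_smul]
  rw [Complex.ofReal_sum, Finset.mul_sum, Finset.sum_mul, ← Finset.sum_add_distrib]
  refine Finset.sum_congr rfl fun k _ => ?_
  have : (ħ : ℂ) ≠ 0 := by exact_mod_cast hħ.ne'
  push_cast
  field_simp
  ring

end Eigenbasis

/-! ### Diagonal operators in a Hilbert basis -/

section Diagonal

variable {κ F : Type*} [NormedAddCommGroup F] [InnerProductSpace ℂ F] (b : HilbertBasis κ ℂ F)

theorem ext_inner_basis {x y : F} (h : ∀ k, inner ℂ (b k) x = inner ℂ (b k) y) : x = y := by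
  apply b.repr.injective
  ext k
  simpa only [b.repr_apply_apply] using h k

theorem hasSum_norm_sq_coeff (x : F) : HasSum (fun k => ‖inner ℂ (b k) x‖ ^ 2) (‖x‖ ^ 2) := by
  have h := b.hasSum_inner_mul_inner x x
  rw [inner_self_eq_norm_sq_to_K] at h
  have h2 : ∀ k, inner ℂ x (b k) * inner ℂ (b k) x = ((‖inner ℂ (b k) x‖ ^ 2 : ℝ) : ℂ) := by
    intro k
    rw [← inner_conj_symm x (b k), Complex.conj_mul']
    push_cast
    rfl
  simp only [h2] at h
  refine Complex.hasSum_ofReal.1 ?_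
  rw [Complex.ofReal_pow]
  exact h

/-- Parseval turns norm convergence into convergence of a series, and the coefficients of the fixed
vector `f` are a square-summable majorant. -/
theorem tendsto_of_coeff {X : Type*} {l : Filter X} {G : X → F} {x : F} (f : F)
    (hb : ∀ᶠ t in l, ∀ k, ‖inner ℂ (b k) (G t) - inner ℂ (b k) x‖ ≤ ‖inner ℂ (b k) f‖)
    (ht : ∀ k, Tendsto (fun t => inner ℂ (b k) (G t)) l (𝓝 (inner ℂ (b k) x))) :
    Tendsto G l (𝓝 x) := by
  have h1 : Tendsto (fun t => ∑' k, ‖inner ℂ (b k) (G t - x)‖ ^ 2) l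
      (𝓝 (∑' _ : κ, (0 : ℝ))) := by
    refine tendsto_tsum_of_dominated_convergence (hasSum_norm_sq_coeff b f).summable
      (fun k => ?_) ?_
    · have h2 := (((ht k).sub_const (inner ℂ (b k) x)).norm.pow 2)
      simpa [inner_sub_right] using h2
    · filter_upwards [hb] with t htb k
      rw [norm_pow, norm_norm, inner_sub_right]
      exact pow_le_pow_left₀ (norm_nonneg _) (htb k) 2
  simp only [(hasSum_norm_sq_coeff b _).tsum_eq, tsum_zero] at h1
  rw [tendsto_iff_norm_sub_tendsto_zero]
  have h3 := (Real.continuous_sqrt.tendsto 0).comp h1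
  simpa [Function.comp_def] using h3

theorem exists_diagonal {c : κ → ℂ} (hc : ∀ k, ‖c k‖ ≤ 1) :
    ∃ D : F →L[ℂ] F, ∀ x k, inner ℂ (b k) (D x) = c k * inner ℂ (b k) x := by
  have hle : ∀ (x : lp (fun _ : κ => ℂ) 2) k, ‖c k * x k‖ ≤ ‖x k‖ := fun x k => by
    rw [norm_mul]
    exact mul_le_of_le_one_left (norm_nonneg _) (hc k)
  have hmem : ∀ x : lp (fun _ : κ => ℂ) 2, Memℓp (fun k => c k * x k) 2 := fun x =>
    (lp.memℓp x).mono' (hle x)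
  let D : lp (fun _ : κ => ℂ) 2 →ₗ[ℂ] lp (fun _ : κ => ℂ) 2 :=
    { toFun := fun x => ⟨fun k => c k * x k, hmem x⟩
      map_add' := fun x y => by
        ext k
        exact mul_add (c k) (x k) (y k)
      map_smul' := fun a x => by
        ext k
        simp [mul_left_comm] }
  let D' : lp (fun _ : κ => ℂ) 2 →L[ℂ] lp (fun _ : κ => ℂ) 2 := D.mkContinuous 1 fun x => by
    rw [one_mul]
    exact lp.norm_mono (by norm_num) (hle x)
  refine ⟨(b.repr.symm.toContinuousLinearEquiv : _ →L[ℂ] F) ∘L D' ∘L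
    (b.repr.toContinuousLinearEquiv : F →L[ℂ] _), fun x k => ?_⟩
  rw [← b.repr_apply_apply, ← b.repr_apply_apply]
  simp [D', D]

theorem inner_diagonal {D : F →L[ℂ] F} {c : κ → ℝ}
    (hD : ∀ x k, inner ℂ (b k) (D x) = c k * inner ℂ (b k) x) (x y : F) :
    HasSum (fun k => (c k : ℂ) * (inner ℂ x (b k) * inner ℂ (b k) y)) (inner ℂ x (D y)) := by
  have h := b.hasSum_inner_mul_inner x (D y)
  simp only [hD] at h
  have h2 : ∀ k, inner ℂ x (b k) * ((c k : ℂ) * inner ℂ (b k) y) =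
      (c k : ℂ) * (inner ℂ x (b k) * inner ℂ (b k) y) := fun k => by ring
  simpa only [h2] using h

theorem isSelfAdjoint_diagonal [CompleteSpace F] {D : F →L[ℂ] F} {c : κ → ℝ}
    (hD : ∀ x k, inner ℂ (b k) (D x) = c k * inner ℂ (b k) x) : IsSelfAdjoint D := by
  rw [ContinuousLinearMap.isSelfAdjoint_iff_isSymmetric]
  intro x y
  change inner ℂ (D x) y = inner ℂ x (D y)
  have h1 := inner_diagonal b hD x y
  have h2 := (inner_diagonal b hD y x).star
  rw [← starRingEnd_apply, inner_conj_symm] at h2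
  refine (h1.unique ?_).symm
  convert h2 using 2 with k
  rw [← starRingEnd_apply, map_mul, map_mul, inner_conj_symm, inner_conj_symm, Complex.conj_ofReal]
  ring

/-- Tonelli for the nonnegative double family `c k * ‖⟨b k, e i⟩‖²`: summing over `i` first gives `c
k`, summing over `k` first gives `⟨e i, D e i⟩`. Hence the same trace results in every basis. -/
theorem hasTrace_diagonal {κ E : Type*} [NormedAddCommGroup E]
    [InnerProductSpace ℂ E] (b : HilbertBasis κ ℂ E) {D : E →L[ℂ] E} {c : κ → ℝ}
    (hc : ∀ k, 0 ≤ c k) (hD : ∀ x k, inner ℂ (b k) (D x) = c k * inner ℂ (b k) x) {τ : ℝ}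
    (hτ : HasSum c τ) : HasTrace D (τ : ℂ) := by
  intro κ' e
  set f : κ × κ' → ℝ := fun p => c p.1 * ‖inner ℂ (b p.1) (e p.2)‖ ^ 2 with hf
  have hrow : ∀ k, HasSum (fun i => f (k, i)) (c k) := by
    intro k
    have h := (hasSum_norm_sq_coeff e (b k)).mul_left (c k)
    rw [b.orthonormal.1 k, one_pow, mul_one] at h
    simpa only [norm_inner_symm] using h
  have hcol : ∀ i, HasSum (fun k => ((f (k, i) : ℝ) : ℂ)) (inner ℂ (e i) (D (e i))) := by
    intro i
    convert inner_diagonal b hD (e i) (e i) using 2 with k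
    rw [← inner_conj_symm (e i) (b k), Complex.conj_mul', hf]
    push_cast
    rfl
  have hnonneg : 0 ≤ f := fun p => mul_nonneg (hc _) (sq_nonneg _)
  have hsum : Summable f := by
    rw [summable_prod_of_nonneg hnonneg]
    refine ⟨fun k => (hrow k).summable, ?_⟩
    simpa only [(hrow _).tsum_eq] using hτ.summable
  have hfτ : HasSum f τ := by
    rw [← (hsum.hasSum.prod_fiberwise hrow).unique hτ]
    exact hsum.hasSum
  have hC : HasSum (fun p : κ' × κ => ((f p.swap : ℝ) : ℂ)) (τ : ℂ) :=
    (Equiv.prodComm κ' κ).hasSum_iff.2 (Complex.hasSum_ofReal.2 hfτ)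
  exact hC.prod_fiberwise hcol

end Diagonal

/-! ### The Boltzmann semigroup of a Hamiltonian with an eigenbasis -/

section Boltzmann

universe u

variable {ι : Type u} [Fintype ι] {H : 𝓢(EuclideanSpace ℝ ι, ℂ) → 𝓢(EuclideanSpace ℝ ι, ℂ)}

theorem norm_exp_slope_add_le {t x : ℝ} (ht : 0 < t) (hx : 0 ≤ x) :
    |t⁻¹ * (Real.exp (-(t * x)) - 1) + x| ≤ x := by
  have h1 : Real.exp (-(t * x)) ≤ 1 := Real.exp_le_one_iff.2 (by nlinarith)
  have h2 : -(t * x) ≤ Real.exp (-(t * x)) - 1 := by linarith [Real.add_one_le_exp (-(t * x))]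
  have h3 : t⁻¹ * (Real.exp (-(t * x)) - 1) ≤ 0 :=
    mul_nonpos_of_nonneg_of_nonpos (by positivity) (by linarith)
  have h4 : t⁻¹ * (-(t * x)) ≤ t⁻¹ * (Real.exp (-(t * x)) - 1) :=
    mul_le_mul_of_nonneg_left h2 (by positivity)
  have h5 : t⁻¹ * (-(t * x)) = -x := by field_simp
  rw [abs_le]
  constructor <;> linarith

theorem exists_boltzmannSemigroup {κ : Type*} (b : HilbertBasis κ ℂ (WaveSpace ι)) {ev : κ → ℝ}
    (hev : ∀ k, 0 ≤ ev k)
    (hH : ∀ ψ k, inner ℂ (b k) ((H ψ).toLp 2) = ev k * inner ℂ (b k) (ψ.toLp 2)) :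
    ∃ T : ℝ → (WaveSpace ι →L[ℂ] WaveSpace ι), IsBoltzmannSemigroup H T ∧
      ∀ t, 0 ≤ t → ∀ x k,
        inner ℂ (b k) (T t x) = (Real.exp (-(t * ev k)) : ℝ) * inner ℂ (b k) x := by
  -- For negative times the diagonal entries may be unbounded; there the junk operator `0` is used.
  have hex : ∀ t : ℝ, ∃ D : WaveSpace ι →L[ℂ] WaveSpace ι, 0 ≤ t → ∀ x k,
      inner ℂ (b k) (D x) = (Real.exp (-(t * ev k)) : ℝ) * inner ℂ (b k) x := by
    intro t
    by_cases ht : 0 ≤ t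
    · obtain ⟨D, hD⟩ := exists_diagonal b (c := fun k => ((Real.exp (-(t * ev k)) : ℝ) : ℂ))
        fun k => by
          rw [Complex.norm_real, Real.norm_of_nonneg (Real.exp_pos _).le]
          exact Real.exp_le_one_iff.2 (by nlinarith [mul_nonneg ht (hev k)])
      exact ⟨D, fun _ => hD⟩
    · exact ⟨0, fun h => absurd h ht⟩
  choose T hT using hex
  refine ⟨T, ⟨?_, fun s t hs ht => ?_, fun t ht => isSelfAdjoint_diagonal b (hT t ht),
    fun f t ht => ?_, fun ψ => ?_⟩, hT⟩
  · refine ContinuousLinearMap.ext fun x => ext_inner_basis b fun k => ?_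
    simp [hT 0 le_rfl]
  · refine ContinuousLinearMap.ext fun x => ext_inner_basis b fun k => ?_
    rw [hT _ (add_nonneg hs ht), mul_apply_eq_comp, hT _ hs, hT _ ht, ← mul_assoc,
      ← Complex.ofReal_mul, ← Real.exp_add]
    congr 3
    ring
  · refine tendsto_of_coeff b f ?_ fun k => ?_
    · filter_upwards [self_mem_nhdsWithin] with s hs k
      rw [hT s hs, hT t ht, ← sub_mul, norm_mul]
      refine mul_le_of_le_one_left (norm_nonneg _) ?_
      rw [← Complex.ofReal_sub, Complex.norm_real, Real.norm_eq_abs]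
      have h1 : ∀ r : ℝ, 0 ≤ r → Real.exp (-(r * ev k)) ≤ 1 := fun r hr =>
        Real.exp_le_one_iff.2 (by nlinarith [mul_nonneg hr (hev k)])
      exact abs_sub_le_of_nonneg_of_le (Real.exp_pos _).le (h1 s hs) (Real.exp_pos _).le (h1 t ht)
    · rw [hT t ht]
      refine Tendsto.congr' (f₁ := fun s : ℝ => ((Real.exp (-(s * ev k)) : ℝ) : ℂ) *
        inner ℂ (b k) f) ?_ ?_
      · filter_upwards [self_mem_nhdsWithin] with s hs
        rw [hT s hs]
      · have hcont : Continuous fun s : ℝ => ((Real.exp (-(s * ev k)) : ℝ) : ℂ) *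
            inner ℂ (b k) f := by fun_prop
        exact (hcont.tendsto t).mono_left nhdsWithin_le_nhds
  · rw [hasDerivWithinAt_iff_tendsto_slope]
    have hpos : ∀ᶠ t : ℝ in 𝓝[Ici 0 \ {0}] 0, 0 < t := by
      filter_upwards [self_mem_nhdsWithin] with t ht
      exact lt_of_le_of_ne ht.1 (Ne.symm ht.2)
    have hcoef : ∀ t : ℝ, 0 < t → ∀ k, inner ℂ (b k) (slope (fun t => T t (ψ.toLp 2)) 0 t) =
        ((t⁻¹ * (Real.exp (-(t * ev k)) - 1) : ℝ) : ℂ) * inner ℂ (b k) (ψ.toLp 2) := by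
      intro t ht k
      rw [slope_def_module, RCLike.real_smul_eq_coe_smul (K := ℂ), inner_smul_right, inner_sub_right, hT t ht.le,
        hT 0 le_rfl]
      push_cast
      simp
      ring
    -- By `norm_exp_slope_add_le` the error in coefficient `k` is at most `ev k` times that of `ψ`,
    -- so `H ψ` itself is the majorant.
    refine tendsto_of_coeff b ((H ψ).toLp 2) ?_ fun k => ?_
    · filter_upwards [hpos] with t ht k
      rw [hcoef t ht, inner_neg_right, hH, sub_neg_eq_add, ← add_mul, norm_mul, norm_mul,
        ← Complex.ofReal_add, Complex.norm_real, Complex.norm_real, Real.norm_eq_abs,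
        Real.norm_of_nonneg (hev k)]
      exact mul_le_mul_of_nonneg_right (norm_exp_slope_add_le ht (hev k)) (norm_nonneg _)
    · rw [inner_neg_right, hH, ← neg_mul]
      refine Tendsto.congr' (f₁ := fun t : ℝ =>
        ((t⁻¹ * (Real.exp (-(t * ev k)) - 1) : ℝ) : ℂ) * inner ℂ (b k) (ψ.toLp 2)) ?_ ?_
      · filter_upwards [hpos] with t ht
        rw [hcoef t ht]
      · refine Tendsto.mul_const _ ?_
        rw [← Complex.ofReal_neg]
        refine (Complex.continuous_ofReal.tendsto _).comp ?_
        have hd : HasDerivAt (fun t : ℝ => Real.exp (-(t * ev k))) (-ev k) 0 := by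
          have := (((hasDerivAt_id (0 : ℝ)).mul_const (ev k)).neg).exp
          simpa using this
        have h2 := hasDerivAt_iff_tendsto_slope.1 hd
        refine (h2.mono_left (nhdsWithin_mono _ fun t ht => ht.2)).congr fun t => ?_
        rw [slope_def_module]
        simp

/-- The semigroup law carries the derivative at `0` to a right derivative at every `s ≥ 0`, so `exp
(s x) • T s f` has zero right derivative and is constant. This gives uniqueness of the partition
function without self-adjointness theory. -/
theorem IsBoltzmannSemigroup.apply_eigenvector
    {T : ℝ → (WaveSpace ι →L[ℂ] WaveSpace ι)} (hT : IsBoltzmannSemigroup H T)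
    {φ : 𝓢(EuclideanSpace ℝ ι, ℂ)} {x : ℝ} (hφ : (H φ).toLp 2 = (x : ℂ) • (φ.toLp 2 : WaveSpace ι))
    {t : ℝ} (ht : 0 ≤ t) :
    T t (φ.toLp 2) = ((Real.exp (-(t * x)) : ℝ) : ℂ) • (φ.toLp 2 : WaveSpace ι) := by
  set f : WaveSpace ι := φ.toLp 2 with hf
  have hder : ∀ s, 0 ≤ s → HasDerivWithinAt (fun r => T r f) (-((x : ℂ) • T s f)) (Ici s) s := by
    intro s hs
    have h0 := hT.hasDerivWithinAt φ
    rw [hφ, ← hf] at h0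
    have h1 : HasDerivWithinAt (fun r : ℝ => r - s) 1 (Ici s) s :=
      ((hasDerivAt_id s).sub_const s).hasDerivWithinAt
    have h2 := HasDerivWithinAt.scomp_of_eq (h := fun r : ℝ => r - s) (t' := Ici 0)
      s h0 h1 (fun r hr => mem_Ici.2 (sub_nonneg.2 hr)) (sub_self s).symm
    have h3 := ((T s).restrictScalars ℝ).hasFDerivAt.comp_hasDerivWithinAt s h2
    refine (h3.congr_of_mem ?_ (self_mem_Ici)).congr_deriv ?_
    · intro r hr
      have h4 := hT.map_add s (r - s) hs (sub_nonneg.2 hr)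
      rw [add_sub_cancel] at h4
      simp [h4]
    · rw [one_smul]
      simp only [ContinuousLinearMap.coe_restrictScalars', map_neg, map_smul]
  have hder2 : ∀ s, 0 ≤ s →
      HasDerivWithinAt (fun r => Real.exp (r * x) • T r f) 0 (Ici s) s := by
    intro s hs
    have h1 : HasDerivWithinAt (fun r : ℝ => Real.exp (r * x)) (Real.exp (s * x) * x) (Ici s) s := by
      have := ((hasDerivAt_id s).mul_const x).exp
      simpa using this.hasDerivWithinAt
    refine (h1.smul (hder s hs)).congr_deriv ?_
    rw [smul_neg, RCLike.real_smul_eq_coe_smul (K := ℂ), RCLike.real_smul_eq_coe_smul (K := ℂ),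
      smul_smul]
    push_cast
    simp
  have hconst := constant_of_has_deriv_right_zero (f := fun r => Real.exp (r * x) • T r f)
    (a := 0) (b := t)
    (by
      refine ContinuousOn.smul (f := fun r : ℝ => Real.exp (r * x))
        (Continuous.continuousOn (by fun_prop))
        ((hT.continuousOn f).mono Icc_subset_Ici_self))
    (fun s hs => hder2 s hs.1) t (right_mem_Icc.2 ht)
  simp only [zero_mul, Real.exp_zero, one_smul, hT.map_zero, one_apply_eq_self]
    at hconst
  conv_rhs => rw [← hconst]
  rw [RCLike.real_smul_eq_coe_smul (K := ℂ), smul_smul]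
  have : ((Real.exp (-(t * x)) : ℝ) : ℂ) * ((Real.exp (t * x) : ℝ) : ℂ) = 1 := by
    rw [← Complex.ofReal_mul, ← Real.exp_add]
    simp
  erw [this]
  rw [one_smul]

/-- The partition function of a Hamiltonian with an eigenbasis of Schwartz functions. -/
theorem partitionFunction_of_eigenbasis {κ : Type u} (b : HilbertBasis κ ℂ (WaveSpace ι))
    (φ : κ → 𝓢(EuclideanSpace ℝ ι, ℂ)) (hb : ∀ k, b k = (φ k).toLp 2) {ev : κ → ℝ}
    (hev : ∀ k, 0 ≤ ev k)
    (hH : ∀ ψ k, inner ℂ (b k) ((H ψ).toLp 2) = ev k * inner ℂ (b k) (ψ.toLp 2))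
    {β Z : ℝ} (hβ : 0 ≤ β) (hZ : HasSum (fun k => Real.exp (-(β * ev k))) Z) :
    HasPartitionFunction H β (partitionFunction H β) ∧ partitionFunction H β = Z := by
  have hex : HasPartitionFunction H β Z := by
    obtain ⟨T, hT, hTb⟩ := exists_boltzmannSemigroup b hev hH
    exact ⟨T, hT, hasTrace_diagonal b (fun k => (Real.exp_pos _).le) (hTb β hβ) hZ⟩
  -- `partitionFunction` picks an arbitrary admissible value, so every admissible value must be
  -- shown to equal `Z`.
  have huniq : ∀ Z', HasPartitionFunction H β Z' → Z' = Z := by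
    rintro Z' ⟨T, hT, htr⟩
    have h1 := htr κ b
    have h2 : ∀ k, inner ℂ (b k) (T β (b k)) = ((Real.exp (-(β * ev k)) : ℝ) : ℂ) := by
      intro k
      have h3 : (H (φ k)).toLp 2 = (ev k : ℂ) • ((φ k).toLp 2 : WaveSpace ι) := by
        refine ext_inner_basis b fun j => ?_
        rw [hH, inner_smul_right, ← hb]
        by_cases h : j = k
        · subst h; rfl
        · rw [b.orthonormal.2 h, mul_zero, mul_zero]
      rw [hb k, hT.apply_eigenvector h3 hβ, ← hb k, inner_smul_right,
        inner_self_eq_norm_sq_to_K, b.orthonormal.1 k]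
      simp
    simp only [h2] at h1
    exact (Complex.hasSum_ofReal.1 h1).unique hZ
  have hdef : HasPartitionFunction H β (partitionFunction H β) := by
    unfold partitionFunction
    rw [dif_pos ⟨Z, hex⟩]
    exact Exists.choose_spec (⟨Z, hex⟩ : ∃ Z, HasPartitionFunction H β Z)
  exact ⟨hdef, huniq _ hdef⟩

end Boltzmann

/-! ### The partition function of coupled harmonic oscillators -/

section Oscillators

/-- Infinite sums of products over finitely many independent indices. -/
theorem hasSum_pi_prod {ι : Type*} [Fintype ι] [DecidableEq ι] {f : ι → ℕ → ℝ} {s : ι → ℝ}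
    (hf : ∀ i n, 0 ≤ f i n) (hs : ∀ i, HasSum (f i) (s i)) :
    HasSum (fun α : ι → ℕ => ∏ i, f i (α i)) (∏ i, s i) := by
  have hbox : ∀ m : ℕ, ∑ α ∈ Fintype.piFinset (fun _ : ι => Finset.range m), ∏ i, f i (α i) =
      ∏ i, ∑ n ∈ Finset.range m, f i n := fun m => (Finset.prod_univ_sum _ _).symm
  have hmono : Monotone fun m : ℕ => Fintype.piFinset (fun _ : ι => Finset.range m) :=
    fun m m' h => Fintype.piFinset_subset _ _ fun _ => Finset.range_mono h
  -- The boxes exhaust the index set, and on each of them the sum factorizes; nonnegativity upgrades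
  -- this to unconditional summability.
  have htop : Tendsto (fun m : ℕ => Fintype.piFinset (fun _ : ι => Finset.range m))
      atTop atTop := by
    refine tendsto_atTop_finset_of_monotone hmono fun α => ⟨(∑ i, α i) + 1, ?_⟩
    rw [Fintype.mem_piFinset]
    intro i
    rw [Finset.mem_range, Nat.lt_succ_iff]
    exact Finset.single_le_sum (fun _ _ => Nat.zero_le _) (Finset.mem_univ i)
  have hnn : ∀ α : ι → ℕ, 0 ≤ ∏ i, f i (α i) := fun α => Finset.prod_nonneg fun i _ => hf i _
  have hsum : Summable fun α : ι → ℕ => ∏ i, f i (α i) := by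
    refine summable_of_sum_le hnn (c := ∏ i, s i) fun u => ?_
    obtain ⟨m, hm⟩ := (htop.eventually_ge_atTop u).exists
    calc ∑ α ∈ u, ∏ i, f i (α i)
        ≤ ∑ α ∈ Fintype.piFinset (fun _ : ι => Finset.range m), ∏ i, f i (α i) :=
          Finset.sum_le_sum_of_subset_of_nonneg hm fun α _ _ => hnn α
      _ = ∏ i, ∑ n ∈ Finset.range m, f i n := hbox m
      _ ≤ ∏ i, s i := Finset.prod_le_prod
          (fun i _ => Finset.sum_nonneg fun n _ => hf i n)
          (fun i _ => sum_le_hasSum _ (fun n _ => hf i n) (hs i))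
  have h1 := hsum.hasSum.comp htop
  have h2 : Tendsto (fun m : ℕ => ∏ i, ∑ n ∈ Finset.range m, f i n) atTop (𝓝 (∏ i, s i)) :=
    tendsto_finsetProd _ fun i _ => (hs i).tendsto_sum_nat
  have h3 := tendsto_nhds_unique (h1.congr fun m => hbox m) h2
  rw [← h3]
  exact hsum.hasSum

theorem hasSum_exp_half_odd {x : ℝ} (hx : 0 < x) :
    HasSum (fun n : ℕ => Real.exp (-(x * (n + 1 / 2)))) (2 * Real.sinh (x / 2))⁻¹ := by
  have h := (hasSum_geometric_of_lt_one (Real.exp_pos (-x)).le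
    (Real.exp_lt_one_iff.2 (neg_lt_zero.2 hx))).mul_left (Real.exp (-(x / 2)))
  have h0 : ∀ n : ℕ, Real.exp (-(x / 2)) * Real.exp (-x) ^ n = Real.exp (-(x * (n + 1 / 2))) := by
    intro n
    rw [← Real.exp_nat_mul, ← Real.exp_add]
    congr 1
    ring
  have h1 : Real.exp (-x) = Real.exp (-(x / 2)) * Real.exp (-(x / 2)) := by
    rw [← Real.exp_add]; congr 1; ring
  have h2 : Real.exp (x / 2) * Real.exp (-(x / 2)) = 1 := by
    rw [← Real.exp_add]; simp
  have h3 : 1 - Real.exp (-x) ≠ 0 := (sub_pos.2 (Real.exp_lt_one_iff.2 (neg_lt_zero.2 hx))).ne'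
  have h4 : 2 * Real.sinh (x / 2) ≠ 0 := by
    have := Real.sinh_pos_iff.2 (half_pos hx)
    positivity
  have h5 : Real.exp (-(x / 2)) * (1 - Real.exp (-x))⁻¹ = (2 * Real.sinh (x / 2))⁻¹ := by
    rw [← div_eq_mul_inv, div_eq_iff h3, eq_comm, inv_mul_eq_iff_eq_mul₀ h4, Real.sinh_eq, h1]
    linear_combination -h2
  rw [← h5]
  simpa only [h0] using h

universe u

variable {ι : Type u} [Fintype ι] [DecidableEq ι]

/-- The linear coordinates given by an invertible matrix. -/
def matrixCoords (B : Matrix ι ι ℝ) (hB : IsUnit B.det) :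
    EuclideanSpace ℝ ι ≃L[ℝ] EuclideanSpace ℝ ι :=
  ContinuousLinearEquiv.equivOfInverse (Matrix.toEuclideanCLM (𝕜 := ℝ) B)
    (Matrix.toEuclideanCLM (𝕜 := ℝ) B⁻¹)
    (fun q => by
      rw [← mul_apply_eq_comp, ← map_mul, Matrix.nonsing_inv_mul _ hB, map_one]; rfl)
    (fun q => by
      rw [← mul_apply_eq_comp, ← map_mul, Matrix.mul_nonsing_inv _ hB, map_one]; rfl)

theorem matrixCoords_apply (B : Matrix ι ι ℝ) (hB : IsUnit B.det) (q : EuclideanSpace ℝ ι)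
    (k : ι) : matrixCoords B hB q k = (B *ᵥ q.ofLp) k := rfl

/-- The mode operators are symmetric on Schwartz functions, so they can be moved onto the Hermite
function, where mode `k` gives `2 α k + 1`. -/
theorem inner_hamiltonian_eigenfunction {ħ : ℝ} (hħ : 0 < ħ) {μ κ B : Matrix ι ι ℝ} {w : ι → ℝ}
    (L : EuclideanSpace ℝ ι ≃L[ℝ] EuclideanSpace ℝ ι) (hL : ∀ q k, L q k = (B *ᵥ q.ofLp) k)
    (hB : B * μ⁻¹ * Bᵀ = Matrix.diagonal (fun k => w k / ħ))
    (hκ : κ = Bᵀ * Matrix.diagonal (fun k => ħ * w k) * B)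
    {φ : 𝓢(EuclideanSpace ℝ ι, ℂ)} {α : ι → ℕ}
    (hφ : ∀ k, raising L k (lowering L k φ) = (α k : ℂ) • φ) (ψ : 𝓢(EuclideanSpace ℝ ι, ℂ)) :
    inner ℂ (φ.toLp 2 volume) ((hamiltonian ħ μ (envPotential κ) ψ).toLp 2 volume) =
      ((∑ k, ħ * w k * (α k + 1 / 2) : ℝ) : ℂ) * inner ℂ (φ.toLp 2 volume) (ψ.toLp 2 volume) := by
  have hmode : ∀ (k : ι) (χ : 𝓢(EuclideanSpace ℝ ι, ℂ)),
      χ = (posOp (coordFun L k) * posOp (coordFun L k)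
        - derOp (coordDir L k) * derOp (coordDir L k)) ψ →
      inner ℂ (φ.toLp 2 volume) (χ.toLp 2 volume) =
        (2 * (α k : ℂ) + 1) * inner ℂ (φ.toLp 2 volume) (ψ.toLp 2 volume) := by
    rintro k _ rfl
    have h1 : (posOp (coordFun L k) * posOp (coordFun L k)
        - derOp (coordDir L k) * derOp (coordDir L k)) φ = (2 * (α k : ℂ) + 1) • φ := by
      have h2 := LinearMap.congr_fun (raising_mul_lowering L k) φ
      rw [Module.End.mul_apply, hφ k, LinearMap.smul_apply, LinearMap.sub_apply,
        Module.End.one_apply] at h2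
      rw [add_smul, mul_smul, h2, one_smul]
      module
    have h3 := congrArg (fun χ : 𝓢(EuclideanSpace ℝ ι, ℂ) =>
      inner ℂ (χ.toLp 2 volume) (ψ.toLp 2 volume)) h1
    have e1 := inner_posOp volume (coordFun L k) φ (posOp (coordFun L k) ψ)
    have e2 := inner_posOp volume (coordFun L k) (posOp (coordFun L k) φ) ψ
    have e3 := inner_derOp volume (coordDir L k) φ (derOp (coordDir L k) ψ)
    have e4 := inner_derOp volume (coordDir L k) (derOp (coordDir L k) φ) ψ
    simp only [LinearMap.sub_apply, Module.End.mul_apply,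
      ← SchwartzMap.toLpCLM_apply (𝕜 := ℂ)] at h3 e1 e2 e3 e4 ⊢
    simp only [map_sub, map_smul, inner_sub_left, inner_sub_right, inner_smul_left, map_add,
      map_mul, map_natCast, map_one, Complex.conj_ofNat] at h3 ⊢
    rw [← h3, e1, e2, e3, e4, neg_neg]
  have hsum := hamiltonian_eq_sum L hħ hL hB hκ ψ
  rw [hsum]
  simp only [← SchwartzMap.toLpCLM_apply (𝕜 := ℂ)] at hmode ⊢
  simp only [map_sum, map_smul, inner_sum, inner_smul_right, hmode _ _ rfl]
  rw [Complex.ofReal_sum, Finset.sum_mul]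
  refine Finset.sum_congr rfl fun k _ => ?_
  push_cast
  ring

theorem partitionFunction_oscillators {μ κ : Matrix ι ι ℝ} {ħ β : ℝ} (hħ : 0 < ħ) (hβ : 0 < β)
    {w : ι → ℝ} {B : Matrix ι ι ℝ} (hw : ∀ k, 0 < w k) (hBdet : IsUnit B.det)
    (hB : B * μ⁻¹ * Bᵀ = Matrix.diagonal (fun k => w k / ħ))
    (hκ : κ = Bᵀ * Matrix.diagonal (fun k => ħ * w k) * B) :
    HasPartitionFunction (hamiltonian ħ μ (envPotential κ)) β
        (partitionFunction (hamiltonian ħ μ (envPotential κ)) β) ∧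
      partitionFunction (hamiltonian ħ μ (envPotential κ)) β =
        ∏ k, (2 * Real.sinh (ħ * β * w k / 2))⁻¹ := by
  obtain ⟨φ, e, he, hφ⟩ := exists_hermite_basis (matrixCoords B hBdet)
  refine partitionFunction_of_eigenbasis e φ he
    (ev := fun α => ∑ k, ħ * w k * (α k + 1 / 2)) (fun α => ?_) (fun ψ α => ?_) hβ.le ?_
  · exact Finset.sum_nonneg fun k _ => by have := hw k; positivity
  · rw [he]
    exact inner_hamiltonian_eigenfunction hħ (matrixCoords B hBdet)
      (matrixCoords_apply B hBdet) hB hκ (fun k => hφ k α) ψ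
  · have h := hasSum_pi_prod (fun k n => (Real.exp_pos _).le)
      (fun k => hasSum_exp_half_odd (mul_pos (mul_pos hħ hβ) (hw k)))
    convert h using 2 with α
    rw [← Real.exp_sum, Finset.mul_sum, ← Finset.sum_neg_distrib]
    congr 1
    refine Finset.sum_congr rfl fun k _ => by ring

end Oscillators

/-! ### Euler's product for the partition function -/

section EulerProduct

/-- Euler's sine product at the imaginary point `i x / (2π)`. -/
theorem hasProd_sinh {x : ℝ} (hx : 0 < x) :
    HasProd (fun r : ℕ => 1 + x ^ 2 / (2 * Real.pi * ((r + 1 : ℕ) : ℝ)) ^ 2)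
      (2 * Real.sinh (x / 2) / x) := by
  have hm : Multipliable fun r : ℕ => 1 + x ^ 2 / (2 * Real.pi * ((r + 1 : ℕ) : ℝ)) ^ 2 := by
    -- Euler's formula concerns only ordered partial products; unconditional convergence comes
    -- separately from `∑ 1/r²`.
    refine Real.multipliable_one_add_of_summable ?_
    have h := (summable_nat_add_iff 1).2 (Real.summable_one_div_nat_pow.2 one_lt_two)
    refine (h.mul_left (x ^ 2 / (2 * Real.pi) ^ 2)).congr fun r => ?_
    rw [div_mul_div_comm, mul_one, ← mul_pow]
  rw [hm.hasProd_iff_tendsto_nat]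
  have hpi : (Real.pi : ℂ) ≠ 0 := by exact_mod_cast Real.pi_ne_zero
  have hx' : (x : ℂ) ≠ 0 := by exact_mod_cast hx.ne'
  have hz : (x / 2 * Complex.I / Real.pi : ℂ) ≠ 0 := by simp [hx', hpi]
  have h := tendsto_euler_sin_prod' hz
  have hlim : Complex.sin (Real.pi * (x / 2 * Complex.I / Real.pi)) /
      (Real.pi * (x / 2 * Complex.I / Real.pi)) = ((2 * Real.sinh (x / 2) / x : ℝ) : ℂ) := by
    rw [mul_div_cancel₀ _ hpi, Complex.sin_mul_I]
    push_cast
    field_simp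
  have hterm : ∀ r : ℕ, 1 + sineTerm (x / 2 * Complex.I / Real.pi) r =
      ((1 + x ^ 2 / (2 * Real.pi * ((r + 1 : ℕ) : ℝ)) ^ 2 : ℝ) : ℂ) := by
    intro r
    have hr : (r : ℂ) + 1 ≠ 0 := Nat.cast_add_one_ne_zero r
    push_cast
    simp only [sineTerm, div_pow, mul_pow, Complex.I_sq]
    field_simp
  rw [hlim] at h
  simp only [hterm, ← Complex.ofReal_prod] at h
  exact Complex.continuous_re.continuousAt.tendsto.comp h

end EulerProduct

/-! ### Block matrices and the Schur complement of the environment -/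

section Blocks

variable {n N : Type*} [Fintype n] [DecidableEq n] [Fintype N] [DecidableEq N]

theorem posDef_fromBlocks_diagonal {A : Matrix n n ℝ} {D : Matrix N N ℝ} (hA : A.PosDef)
    (hD : D.PosDef) : (Matrix.fromBlocks A 0 0 D).PosDef := by
  refine Matrix.PosDef.of_dotProduct_mulVec_pos ?_ fun x hx => ?_
  · rw [Matrix.isHermitian_fromBlocks_iff]
    exact ⟨hA.1, by simp, by simp, hD.1⟩
  · obtain ⟨u, v, rfl⟩ : ∃ u v, x = Sum.elim u v := ⟨_, _, (Sum.elim_comp_inl_inr x).symm⟩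
    have hs : star (Sum.elim u v) = Sum.elim u v := rfl
    rw [hs, Matrix.fromBlocks_mulVec, sumElim_dotProduct_sumElim]
    simp only [Sum.elim_comp_inl, Sum.elim_comp_inr, Matrix.zero_mulVec, add_zero, zero_add]
    have h1 := hA.posSemidef.dotProduct_mulVec_nonneg u
    have h2 := hD.posSemidef.dotProduct_mulVec_nonneg v
    by_cases hu : u = 0
    · have hv : v ≠ 0 := by
        rintro rfl
        apply hx
        rw [hu]
        funext i
        cases i <;> rfl
      exact add_pos_of_nonneg_of_pos h1 (hD.dotProduct_mulVec_pos hv)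
    · exact add_pos_of_pos_of_nonneg (hA.dotProduct_mulVec_pos hu) h2

/-- The coordinate change `(X, x) ↦ (X, x - c⁻¹ g X)`. -/
def shiftMatrix (c : Matrix N N ℝ) (g : Matrix N n ℝ) : Matrix (n ⊕ N) (n ⊕ N) ℝ :=
  Matrix.fromBlocks 1 0 (-(c⁻¹ * g)) 1

/-- The spring matrix of the closed system. -/
def closedSpring (C : Matrix n n ℝ) (c : Matrix N N ℝ) (g : Matrix N n ℝ) :
    Matrix (n ⊕ N) (n ⊕ N) ℝ :=
  (shiftMatrix c g)ᵀ * Matrix.fromBlocks C 0 0 c * shiftMatrix c g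

theorem det_shiftMatrix (c : Matrix N N ℝ) (g : Matrix N n ℝ) : (shiftMatrix c g).det = 1 := by
  rw [shiftMatrix, Matrix.det_fromBlocks_zero₁₂]
  simp

theorem closedSpring_posDef {C : Matrix n n ℝ} {c : Matrix N N ℝ} (hC : C.PosDef)
    (hc : c.PosDef) (g : Matrix N n ℝ) : (closedSpring C c g).PosDef := by
  have hU : IsUnit (shiftMatrix c g) := by
    rw [Matrix.isUnit_iff_isUnit_det, det_shiftMatrix]
    exact isUnit_one
  have h := (Matrix.IsUnit.posDef_star_left_conjugate_iff hU
    (x := Matrix.fromBlocks C 0 0 c)).2 (posDef_fromBlocks_diagonal hC hc)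
  exact h

theorem det_closedSpring (C : Matrix n n ℝ) (c : Matrix N N ℝ) (g : Matrix N n ℝ) :
    (closedSpring C c g).det = C.det * c.det := by
  rw [closedSpring, Matrix.det_mul, Matrix.det_mul, Matrix.det_transpose, det_shiftMatrix,
    Matrix.det_fromBlocks_zero₂₁]
  ring

theorem closedSpring_eq {C : Matrix n n ℝ} {c : Matrix N N ℝ} (hc : c.PosDef)
    (g : Matrix N n ℝ) :
    closedSpring C c g = Matrix.fromBlocks (C + gᵀ * c⁻¹ * g) (-gᵀ) (-g) c := by
  have hu : IsUnit c.det := hc.det_pos.ne'.isUnit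
  have ht : (c⁻¹)ᵀ = c⁻¹ := by simpa using hc.inv.1.eq
  have h1 : c * (c⁻¹ * g) = g := by
    rw [← Matrix.mul_assoc, Matrix.mul_nonsing_inv _ hu, Matrix.one_mul]
  have h2 : gᵀ * c⁻¹ * c = gᵀ := by
    rw [Matrix.mul_assoc, Matrix.nonsing_inv_mul _ hu, Matrix.mul_one]
  rw [closedSpring, shiftMatrix, Matrix.fromBlocks_transpose, Matrix.fromBlocks_multiply,
    Matrix.fromBlocks_multiply]
  simp [Matrix.transpose_mul, ht, h1, h2, Matrix.mul_assoc]

theorem closedPotential_eq (C : Matrix n n ℝ) (c : Matrix N N ℝ) (g : Matrix N n ℝ) :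
    closedPotential C c g = envPotential (closedSpring C c g) := by
  funext q
  have hq : q.ofLp = Sum.elim (sysPart q) (envPart q) := (Sum.elim_comp_inl_inr _).symm
  rw [envPotential, closedSpring, ← Matrix.mulVec_mulVec, ← Matrix.mulVec_mulVec,
    Matrix.dotProduct_mulVec, Matrix.vecMul_transpose, hq, shiftMatrix,
    Matrix.fromBlocks_mulVec, Matrix.fromBlocks_mulVec,
    sumElim_dotProduct_sumElim, closedPotential]
  simp only [Sum.elim_comp_inl, Sum.elim_comp_inr, Matrix.zero_mulVec, Matrix.one_mulVec, add_zero, zero_add, Matrix.neg_mulVec,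
    neg_add_eq_sub]
  ring

/-- Schur complement of the environment block. The term `gᵀ c⁻¹ g` from expanding the square
combines with `-gᵀ (z² m + c)⁻¹ g`. -/
theorem det_closed {M C : Matrix n n ℝ} {m c : Matrix N N ℝ} (hm : m.PosDef) (hc : c.PosDef)
    (g : Matrix N n ℝ) (z : ℝ) :
    (z ^ 2 • Matrix.fromBlocks M 0 0 m + closedSpring C c g).det = (z ^ 2 • m + c).det *
      (z ^ 2 • M + gᵀ * (c⁻¹ - (z ^ 2 • m + c)⁻¹) * g + C).det := by
  have hp : (z ^ 2 • m + c).PosDef := by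
    have := Matrix.PosDef.posSemidef_add (hm.posSemidef.smul (sq_nonneg z)) hc
    exact this
  let _ : Invertible (z ^ 2 • m + c) := Matrix.invertibleOfIsUnitDet _ hp.det_pos.ne'.isUnit
  rw [closedSpring_eq hc, Matrix.fromBlocks_smul, Matrix.fromBlocks_add,
    Matrix.det_fromBlocks₂₂, Matrix.invOf_eq_nonsing_inv]
  congr 2
  simp only [smul_zero, zero_add, Matrix.mul_sub, Matrix.sub_mul, Matrix.neg_mul, Matrix.mul_neg,
    neg_neg]
  abel

end Blocks

/-! ### The damping kernel -/

section Damping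

variable {n N : Type*} [Fintype n] [DecidableEq n] [Fintype N] [DecidableEq N]

/-- Real part of the integral of `exp ((-z + i w) t)`. -/
theorem integral_exp_mul_cos {z : ℝ} (hz : 0 < z) (w : ℝ) :
    IntegrableOn (fun t : ℝ => Real.exp (-z * t) * Real.cos (w * t)) (Ioi 0) ∧
      ∫ t in Ioi (0 : ℝ), Real.exp (-z * t) * Real.cos (w * t) = z / (z ^ 2 + w ^ 2) := by
  set a : ℂ := -z + w * Complex.I with ha
  have hre : a.re < 0 := by simp [ha, hz]
  have hint := integrableOn_exp_mul_complex_Ioi hre 0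
  have heq : ∀ t : ℝ, (Complex.exp (a * t)).re = Real.exp (-z * t) * Real.cos (w * t) := by
    intro t
    rw [Complex.exp_re]
    simp [ha]
  have hint' : IntegrableOn (fun t : ℝ => (Complex.exp (a * t)).re) (Ioi 0) := hint.re
  refine ⟨by simpa only [heq] using hint', ?_⟩
  have h1 : ∫ t in Ioi (0 : ℝ), (Complex.exp (a * t)).re =
      (∫ t in Ioi (0 : ℝ), Complex.exp (a * t)).re := integral_re hint
  simp only [heq] at h1
  rw [h1, integral_exp_mul_complex_Ioi hre]
  simp only [Complex.ofReal_zero, mul_zero, Complex.exp_zero, Complex.div_re]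
  simp [ha, Complex.normSq_apply]
  ring

/-- In the eigenbasis of `ω` this is the partial fraction `2z · (2w²)⁻¹ · z / (z² + w²) = 1/w² -
1/(z² + w²)` in each mode. -/
theorem two_mul_laplace_damping {m c : Matrix N N ℝ} (hm : m.PosDef) (hc : c.PosDef)
    (g : Matrix N n ℝ) {z : ℝ} (hz : 0 < z) :
    (2 * z) • laplace (damping m c g) z = gᵀ * (c⁻¹ - (z ^ 2 • m + c)⁻¹) * g := by
  obtain ⟨U, w, h1, h2, hw, hf, -, hd⟩ := exists_freq_diagonalization hm hc
  set A : Matrix n N ℝ := gᵀ * (msqrt m)⁻¹ * U with hA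
  have hRt : ((msqrt m)⁻¹)ᵀ = (msqrt m)⁻¹ := by
    rw [Matrix.transpose_nonsing_inv, msqrt_transpose hm]
  have hAt : Aᵀ = Uᵀ * (msqrt m)⁻¹ * g := by
    simp only [hA, Matrix.transpose_mul, Matrix.transpose_transpose, hRt, Matrix.mul_assoc]
  have hsand : ∀ d : N → ℝ,
      gᵀ * (msqrt m)⁻¹ * (U * Matrix.diagonal d * Uᵀ) * (msqrt m)⁻¹ * g =
        A * Matrix.diagonal d * Aᵀ := by
    intro d
    rw [hAt]
    simp only [hA, Matrix.mul_assoc]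
  have hentry : ∀ (d : N → ℝ) a b, (A * Matrix.diagonal d * Aᵀ) a b =
      ∑ k, A a k * A b k * d k := by
    intro d a b
    rw [Matrix.mul_apply]
    refine Finset.sum_congr rfl fun k _ => ?_
    rw [Matrix.mul_diagonal, Matrix.transpose_apply]
    ring
  have hinv : ∀ y : ℝ, gᵀ * (y ^ 2 • m + c)⁻¹ * g =
      A * Matrix.diagonal (fun k => (y ^ 2 + w k ^ 2)⁻¹) * Aᵀ := by
    intro y
    rw [hd y, Matrix.mul_inv_rev, Matrix.mul_inv_rev, inv_orthogonal_conj_diagonal h1 h2, ← hsand]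
    · simp only [Matrix.mul_assoc]
    · intro k
      have := hw k
      positivity
  -- The value at `0` provides the `c⁻¹` term.
  have hinv0 := hinv 0
  simp only [ne_eq, OfNat.ofNat_ne_zero, not_false_eq_true, zero_pow, zero_smul, zero_add] at hinv0
  rw [Matrix.mul_sub, Matrix.sub_mul, hinv, hinv0]
  ext a b
  rw [Matrix.sub_apply, hentry, hentry, ← Finset.sum_sub_distrib, Matrix.smul_apply, laplace,
    Matrix.of_apply]
  have hdamp : ∀ t, Real.exp (-z * t) * damping m c g t a b =
      ∑ k, A a k * A b k / (2 * w k ^ 2) * (Real.exp (-z * t) * Real.cos (w k * t)) := by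
    intro t
    rw [damping, hf, hsand, hentry, Finset.mul_sum]
    refine Finset.sum_congr rfl fun k _ => by ring
  simp only [hdamp]
  rw [integral_finsetSum _ fun k _ => ((integral_exp_mul_cos hz (w k)).1.const_mul _), smul_eq_mul,
    Finset.mul_sum]
  refine Finset.sum_congr rfl fun k _ => ?_
  rw [integral_const_mul, (integral_exp_mul_cos hz (w k)).2]
  have h3 := hw k
  have h4 : z ^ 2 + w k ^ 2 ≠ 0 := by positivity
  field_simp
  ring

end Damping

/-! ### The partition function of the closed system -/

section Main

universe u

theorem matsubara_pos {ħ β : ℝ} (hħ : 0 < ħ) (hβ : 0 < β) (r : ℕ) :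
    0 < matsubara ħ β (r + 1) := by
  unfold matsubara
  positivity

theorem det_sq_smul_pos {ι : Type*} [Fintype ι] [DecidableEq ι] {μ : Matrix ι ι ℝ}
    (hμ : μ.PosDef) {z : ℝ} (hz : 0 < z) : 0 < (z ^ 2 • μ).det :=
  (hμ.smul (pow_pos hz 2)).det_pos

/-- Coupled harmonic oscillators have a partition function, which is given by an infinite product
over the Matsubara frequencies. -/
theorem hasProd_matsubara {ι : Type u} [Fintype ι] [DecidableEq ι] {μ κ : Matrix ι ι ℝ}
    (hμ : μ.PosDef) (hκ : κ.PosDef) {ħ β : ℝ} (hħ : 0 < ħ) (hβ : 0 < β) :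
    HasPartitionFunction (hamiltonian ħ μ (envPotential κ)) β
        (partitionFunction (hamiltonian ħ μ (envPotential κ)) β) ∧
      0 < partitionFunction (hamiltonian ħ μ (envPotential κ)) β ∧
      HasProd (fun r : ℕ => (matsubara ħ β (r + 1) ^ 2 • μ + κ).det /
          (matsubara ħ β (r + 1) ^ 2 • μ).det)
        (partitionFunction (hamiltonian ħ μ (envPotential κ)) β *
          ((ħ * β) • freq μ κ).det)⁻¹ := by
  obtain ⟨w, B, hw, hBdet, hB, hκB, hdet, hz⟩ := exists_normalModes hμ hκ hħ
  obtain ⟨h1, h2⟩ := partitionFunction_oscillators hħ hβ hw hBdet hB hκB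
  have hx : ∀ k, 0 < ħ * β * w k := fun k => mul_pos (mul_pos hħ hβ) (hw k)
  have hs : ∀ k, 0 < Real.sinh (ħ * β * w k / 2) := fun k =>
    Real.sinh_pos_iff.2 (half_pos (hx k))
  refine ⟨h1, ?_, ?_⟩
  · rw [h2]
    exact Finset.prod_pos fun k _ => by have := hs k; positivity
  · have hprod := hasProd_prod (s := Finset.univ) fun k _ => hasProd_sinh (hx k)
    have hval : ∏ k, 2 * Real.sinh (ħ * β * w k / 2) / (ħ * β * w k) =
        (partitionFunction (hamiltonian ħ μ (envPotential κ)) β *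
          ((ħ * β) • freq μ κ).det)⁻¹ := by
      rw [h2, Matrix.det_smul, ← hdet, Finset.prod_div_distrib, Finset.prod_inv_distrib,
        Finset.prod_mul_distrib (f := fun _ => ħ * β), Finset.prod_const, Finset.card_univ,
        mul_inv, inv_inv, div_eq_mul_inv]
    rw [← hval]
    convert hprod using 2 with r
    have hν := matsubara_pos hħ hβ r
    rw [hz, Matrix.det_smul, mul_comm _ μ.det, mul_div_mul_left _ _ hμ.det_pos.ne',
      ← Finset.card_univ, ← Finset.prod_const, ← Finset.prod_div_distrib]
    refine Finset.prod_congr rfl fun k _ => ?_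
    -- Modewise, `(ν² + w²) / ν² = 1 + (ħβw)² / (2π(r + 1))²` for `ν = 2π(r + 1) / (ħβ)`.
    rw [add_div, div_self (pow_pos hν 2).ne', matsubara]
    congr 1
    field_simp

variable {n N : Type*} [Fintype n] [DecidableEq n] [Fintype N] [DecidableEq N]

/-- By `det_closed` the inverse propagator is the Schur complement, so each factor of the final
product is an environment factor over a closed-system factor of `hasProd_matsubara`. -/
theorem det_mul_propagator {M C : Matrix n n ℝ} {m c : Matrix N N ℝ} (hM : M.PosDef)
    (hC : C.PosDef) (hm : m.PosDef) (hc : c.PosDef) (g : Matrix N n ℝ) {z : ℝ} (hz : 0 < z) :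
    (M * (z ^ 2 • propagator M C m c g z)).det =
      ((z ^ 2 • m + c).det / (z ^ 2 • m).det) /
        ((z ^ 2 • Matrix.fromBlocks M 0 0 m + closedSpring C c g).det /
          (z ^ 2 • Matrix.fromBlocks M 0 0 m).det) := by
  have h1 := det_closed (M := M) (C := C) hm hc g z
  have h2 := (((posDef_fromBlocks_diagonal hM hm).smul (pow_pos hz 2)).add
    (closedSpring_posDef hC hc g)).det_pos
  have h3 := ((hm.smul (pow_pos hz 2)).add hc).det_pos
  have h4 := det_sq_smul_pos hm hz
  have h5 := det_sq_smul_pos hM hz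
  have h6 : (z ^ 2 • Matrix.fromBlocks M 0 0 m).det = (z ^ 2 • M).det * (z ^ 2 • m).det := by
    rw [Matrix.fromBlocks_smul, smul_zero, smul_zero, Matrix.det_fromBlocks_zero₂₁]
  have h7 : M * (z ^ 2 • propagator M C m c g z) = (z ^ 2 • M) * propagator M C m c g z := by
    rw [Matrix.mul_smul, Matrix.smul_mul]
  rw [h7, Matrix.det_mul, propagator, Matrix.det_nonsing_inv, Ring.inverse_eq_inv',
    two_mul_laplace_damping hm hc g hz, h6, h1]
  rw [h1] at h2
  -- The Schur determinant is positive because the full and the environment determinants are; this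
  -- permits clearing denominators.
  have h8 := (pos_iff_pos_of_mul_pos h2).1 h3
  field_simp

/-- The shear has determinant `1`, so the coupling changes the individual normal frequencies but not
their product. -/
theorem det_freq_closed {M C : Matrix n n ℝ} {m c : Matrix N N ℝ} (hM : M.PosDef)
    (hC : C.PosDef) (hm : m.PosDef) (hc : c.PosDef) (g : Matrix N n ℝ) (a : ℝ) :
    (a • freq (Matrix.fromBlocks M 0 0 m) (closedSpring C c g)).det =
      (a • freq M C).det * (a • freq m c).det := by
  rw [Matrix.det_smul, Matrix.det_smul, Matrix.det_smul,
    det_freq (posDef_fromBlocks_diagonal hM hm) (closedSpring_posDef hC hc g), det_freq hM hC,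
    det_freq hm hc, det_closedSpring, Matrix.det_fromBlocks_zero₂₁, Fintype.card_sum, pow_add,
    mul_div_mul_comm, Real.sqrt_mul (div_pos hC.det_pos hM.det_pos).le]
  ring

end Main

end NQBM

end

theorem mainTheorem4 {n N : Type*} [Fintype n] [DecidableEq n] [Fintype N] [DecidableEq N]
    (M C : Matrix n n ℝ) (m c : Matrix N N ℝ) (g : Matrix N n ℝ)
    (hM : M.PosDef) (hC : C.PosDef) (hm : m.PosDef) (hc : c.PosDef)
    (ħ β : ℝ) (hħ : 0 < ħ) (hβ : 0 < β) :
    NQBM.HasPartitionFunction (NQBM.closedHamiltonian ħ M C m c g) β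
        (NQBM.partitionFunction (NQBM.closedHamiltonian ħ M C m c g) β) ∧
      NQBM.HasPartitionFunction (NQBM.envHamiltonian ħ m c) β
        (NQBM.partitionFunction (NQBM.envHamiltonian ħ m c) β) ∧
      Multipliable (fun r : ℕ => (M * ((NQBM.matsubara ħ β (r + 1)) ^ 2 •
        NQBM.propagator M C m c g (NQBM.matsubara ħ β (r + 1)))).det) ∧
      NQBM.partitionFunction (NQBM.closedHamiltonian ħ M C m c g) β =
        NQBM.partitionFunction (NQBM.envHamiltonian ħ m c) β *
          (((ħ * β) • NQBM.freq M C)⁻¹).det *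
          ∏' r : ℕ, (M * ((NQBM.matsubara ħ β (r + 1)) ^ 2 •
            NQBM.propagator M C m c g (NQBM.matsubara ħ β (r + 1)))).det := by
  have hclosed : NQBM.closedHamiltonian ħ M C m c g =
      NQBM.hamiltonian ħ (Matrix.fromBlocks M 0 0 m)
        (NQBM.envPotential (NQBM.closedSpring C c g)) := by
    rw [NQBM.closedHamiltonian, NQBM.closedPotential_eq]
  have henv : NQBM.envHamiltonian ħ m c = NQBM.hamiltonian ħ m (NQBM.envPotential c) := rfl
  obtain ⟨hC1, hC2, hC3⟩ := NQBM.hasProd_matsubara (NQBM.posDef_fromBlocks_diagonal hM hm)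
    (NQBM.closedSpring_posDef hC hc g) hħ hβ
  obtain ⟨hE1, hE2, hE3⟩ := NQBM.hasProd_matsubara hm hc hħ hβ
  rw [← hclosed] at hC1 hC2 hC3
  rw [← henv] at hE1 hE2 hE3
  have hħβ : 0 < ħ * β := mul_pos hħ hβ
  have hdS := ((NQBM.freq_posDef hM hC).smul hħβ).det_pos
  have hdE := ((NQBM.freq_posDef hm hc).smul hħβ).det_pos
  rw [NQBM.det_freq_closed hM hC hm hc g] at hC3
  -- The quotient of the limits is `Z_C det (ħβΩ) / Z_E`, the two factors `det (ħβω)` cancelling.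
  have hprod := hE3.div₀ hC3 (inv_pos.2 (mul_pos hC2 (mul_pos hdS hdE))).ne'
  simp only [← NQBM.det_mul_propagator hM hC hm hc g (NQBM.matsubara_pos hħ hβ _)] at hprod
  refine ⟨hC1, hE1, hprod.multipliable, ?_⟩
  rw [hprod.tprod_eq, Matrix.det_nonsing_inv, Ring.inverse_eq_inv']
  field_simp
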